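/- Let $\Omega=(0,1)^2$ and $b(x,y)=(x/2,\,y/2)$. Let $V=H^1_0(\Omega)$ (real-valued functions) with inner product $(u,v)_V=(u,v)_0+(\nabla u,\nabla v)_0$, where $(\cdot,\cdot)_0$ denotes the inner product of $L^2(\Omega)$, of $[L^2(\Omega)]^2$, or of $Y=[L^2(\Omega)]^2\times L^2(\Omega)$. Define bounded operators $\mathcal L,\mathcal M:V\to Y$ by $\mathcal L u=(\nabla u,\;u+b\cdot\nabla u)$ and $\mathcal M u=(\nabla u,\;u)$, and the bilinear form $$a(u,v)=(\mathcal L u,\mathcal M v)_0=(\nabla u,\nabla v)_0+(b\cdot\nabla u,v)_0+(u,v)_0 ,\qquad u,v\in V.$$ Let $A:V\to V'$ be given by $\langle Au,v\rangle=\tfrac12(\mathcal L u,\mathcal M v)_0+\tfrac12(\mathcal M u,\mathcal L v)_0$, let $R_V:V\to V'$ be the Riesz map $\langle R_Vu,v\rangle=(u,v)_V$, and put $K=A^{-1}R_V$ and $C=K-I$ on $V$. For integers $m,n\ge 1$ let $\beta_{mn}=(m^2+n^2)\pi^2$. Then: 1. $A:V\to V'$ and $K:V\to V$ are bounded and invertible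 with bounded inverse. 2. The set of eigenvalues of $C$ is exactly $\{(1+2\beta_{mn})^{-1}: m,n\ge1\}$, and the set of eigenvalues of $K$ is exactly $\left\{\frac{2+2\beta_{mn}}{1+2\beta_{mn}}: m,n\ge 1\right\}$. 3. The functions $e_{jk}(x,y)=\sin(j\pi x)\sin(k\pi y)$ belong to $V$. For all $m,n\ge1$, the eigenspace of $C$ for $(1+2\beta_{mn})^{-1}$ and the eigenspace of $K$ for $\frac{2+2\beta_{mn}}{1+2\beta_{mn}}$ are both equal to $\operatorname{span}\{e_{jk}: j,k\ge1,\ j^2+k^2=m^2+n^2\}$. 4. The coercivity constant of $a$, that is, the largest $\alpha>0$ such that $a(u,u)\ge\alpha\|u\|_V^2$ for all $u\in V$, equals $$\alpha=\inf_{0\ne u\in V}\frac{a(u,u)}{\|u\|_V^2}=\frac{1+4\pi^2}{2+4\pi^2},$$ and the eigenspace of $K^{-1}$ for the value $\alpha$ is $\operatorname{span}\{\sin(\pi x)\sin(\pi y)\}$. -/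

import Mathlib

open MeasureTheory Set
open scoped ENNReal ContDiff RealInnerProductSpace

noncomputable section

namespace AdvDiff

/-! ### Abstract setting: `a(u, v) = (L u, M v)_Y` -/

section Abstract

variable {V Y : Type*} [NormedAddCommGroup V] [InnerProductSpace ℝ V]
  [NormedAddCommGroup Y] [InnerProductSpace ℝ Y]

/-- The Riesz map `R_V : V → V'`, `⟨R_V u, v⟩ = (u, v)_V`. -/
def rieszMap (V : Type*) [NormedAddCommGroup V] [InnerProductSpace ℝ V] :
    V →L[ℝ] StrongDual ℝ V := innerSL ℝ

/-- The adjoint `T' : Y → V'` of `T : V → Y` with `Y` a pivot space (identified with its dual):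
`⟨T' g, v⟩ = (g, T v)_Y`. -/
def pivotAdjoint (T : V →L[ℝ] Y) : Y →L[ℝ] StrongDual ℝ V :=
  (ContinuousLinearMap.precomp ℝ T) ∘L (innerSL ℝ : Y →L[ℝ] StrongDual ℝ Y)

theorem pivotAdjoint_apply (T : V →L[ℝ] Y) (g : Y) (v : V) :
    pivotAdjoint T g v = ⟪g, T v⟫ := rfl

/-- `A = (M' L + L' M) / 2 : V → V'`. -/
def opA (L M : V →L[ℝ] Y) : V →L[ℝ] StrongDual ℝ V :=
  (1 / 2 : ℝ) • (pivotAdjoint M ∘L L + pivotAdjoint L ∘L M)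

/-- `K = A⁻¹ R_V : V → V`. (`ContinuousLinearMap.inverse` is the inverse if `A` is invertible.) -/
def opK (L M : V →L[ℝ] Y) : V →L[ℝ] V := (opA L M).inverse ∘L rieszMap V

/-- `C = K - I`. -/
def opC (L M : V →L[ℝ] Y) : V →L[ℝ] V := opK L M - ContinuousLinearMap.id ℝ V

/-- The bilinear form `a(u, v) = (L u, M v)_Y`. -/
def form (L M : V →L[ℝ] Y) (u v : V) : ℝ := ⟪L u, M v⟫

/-- `α` is the coercivity constant of `a`: the largest positive number
with `a(u, u) ≥ α ‖u‖²` for all `u`. -/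
def IsCoercivityConstant (a : V → V → ℝ) (α : ℝ) : Prop :=
  IsGreatest {c : ℝ | 0 < c ∧ ∀ u : V, c * ‖u‖ ^ 2 ≤ a u u} α

end Abstract

/-! ### Sobolev space `H₀¹(Ω)` -/

section Sobolev

variable {d : ℕ}

/-- `L²(Ω)`. -/
abbrev L2 (Ω : Set (EuclideanSpace ℝ (Fin d))) : Type := Lp ℝ 2 (volume.restrict Ω)

/-- `[L²(Ω)]^d`. -/
abbrev L2Vec (Ω : Set (EuclideanSpace ℝ (Fin d))) : Type :=
  Lp (EuclideanSpace ℝ (Fin d)) 2 (volume.restrict Ω)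

/-- `φ ∈ C_c^∞(Ω)`. -/
structure IsTest (Ω : Set (EuclideanSpace ℝ (Fin d))) (φ : EuclideanSpace ℝ (Fin d) → ℝ) :
    Prop where
  smooth : ContDiff ℝ ∞ φ
  compact : HasCompactSupport φ
  supp : tsupport φ ⊆ Ω

/-- `g` is the weak gradient of `u` on `Ω`. -/
def IsWeakGradient {Ω : Set (EuclideanSpace ℝ (Fin d))} (u : L2 Ω) (g : L2Vec Ω) : Prop :=
  ∀ φ, IsTest Ω φ → ∀ i : Fin d,
    ∫ x in Ω, u x * gradient φ x i = -∫ x in Ω, g x i * φ x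

/-- Pairs `(φ, ∇φ)` with `φ ∈ C_c^∞(Ω)`. -/
def testPairs (Ω : Set (EuclideanSpace ℝ (Fin d))) : Set (WithLp 2 (L2 Ω × L2Vec Ω)) :=
  {p | ∃ φ, IsTest Ω φ ∧ p.fst =ᵐ[volume.restrict Ω] φ ∧
    p.snd =ᵐ[volume.restrict Ω] gradient φ}

/-- `H₀¹(Ω)`, the closure of `C_c^∞(Ω)` in the norm `‖u‖² = ‖u‖₀² + ‖∇u‖₀²`. A function `u` is
represented by the pair `(u, ∇u)`, so that the inherited inner product is
`(u, v)₀ + (∇u, ∇v)₀`. -/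
def H10 (Ω : Set (EuclideanSpace ℝ (Fin d))) : Submodule ℝ (WithLp 2 (L2 Ω × L2Vec Ω)) :=
  (Submodule.span ℝ (testPairs Ω)).topologicalClosure

instance (Ω : Set (EuclideanSpace ℝ (Fin d))) : CompleteSpace (H10 Ω) :=
  inferInstanceAs (CompleteSpace (Submodule.span ℝ (testPairs Ω)).topologicalClosure)

/-- The inclusion `I_X : H₀¹(Ω) → L²(Ω)`. -/
def incl (Ω : Set (EuclideanSpace ℝ (Fin d))) : H10 Ω →L[ℝ] L2 Ω :=
  WithLp.fstL 2 ℝ (L2 Ω) (L2Vec Ω) ∘L (H10 Ω).subtypeL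

/-- The gradient `∇ : H₀¹(Ω) → [L²(Ω)]^d`. -/
def grad (Ω : Set (EuclideanSpace ℝ (Fin d))) : H10 Ω →L[ℝ] L2Vec Ω :=
  WithLp.sndL 2 ℝ (L2 Ω) (L2Vec Ω) ∘L (H10 Ω).subtypeL

theorem inner_H10 {Ω : Set (EuclideanSpace ℝ (Fin d))} (u v : H10 Ω) :
    ⟪u, v⟫ = ⟪incl Ω u, incl Ω v⟫ + ⟪grad Ω u, grad Ω v⟫ := rfl

theorem isWeakGradient_grad {Ω : Set (EuclideanSpace ℝ (Fin d))} (u : H10 Ω) :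
    IsWeakGradient (incl Ω u) (grad Ω u) := by
  intro φ hφ i
  have hgc : Continuous fun x => gradient φ x i :=
    (EuclideanSpace.proj (𝕜 := ℝ) i).continuous.comp
      ((InnerProductSpace.toDual ℝ _).symm.continuous.comp
        (hφ.smooth.continuous_fderiv (by simp)))
  have hgs : HasCompactSupport fun x => gradient φ x i :=
    (hφ.compact.fderiv ℝ).comp_left
      (g := fun f => (InnerProductSpace.toDual ℝ (EuclideanSpace ℝ (Fin d))).symm f i) (by simp)
  have h1 : MemLp (fun x => gradient φ x i) 2 (volume.restrict Ω) :=
    (hgc.memLp_of_hasCompactSupport hgs).restrict Ω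
  have h2 : MemLp (fun x => φ x • EuclideanSpace.single i (1 : ℝ)) 2 (volume.restrict Ω) :=
    ((hφ.smooth.continuous.smul continuous_const).memLp_of_hasCompactSupport
      hφ.compact.smul_right).restrict Ω
  have k1 : ∀ f : L2 Ω, ⟪h1.toLp _, f⟫ = ∫ x in Ω, f x * gradient φ x i := by
    intro f
    rw [MeasureTheory.L2.inner_def]
    refine integral_congr_ae ?_
    filter_upwards [h1.coeFn_toLp] with x hx
    rw [hx]; simp
  have k2 : ∀ f : L2Vec Ω, ⟪h2.toLp _, f⟫ = ∫ x in Ω, f x i * φ x := by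
    intro f
    rw [MeasureTheory.L2.inner_def]
    refine integral_congr_ae ?_
    filter_upwards [h2.coeFn_toLp] with x hx
    rw [hx, real_inner_smul_left, EuclideanSpace.inner_single_left]
    simp [mul_comm]
  let F : WithLp 2 (L2 Ω × L2Vec Ω) →L[ℝ] ℝ :=
    innerSL ℝ (h1.toLp _) ∘L WithLp.fstL 2 ℝ (L2 Ω) (L2Vec Ω) +
      innerSL ℝ (h2.toLp _) ∘L WithLp.sndL 2 ℝ (L2 Ω) (L2Vec Ω)
  have hF : ∀ p, F p = (∫ x in Ω, p.fst x * gradient φ x i) + ∫ x in Ω, p.snd x i * φ x := by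
    intro p
    rw [← k1, ← k2]
    rfl
  have hle : H10 Ω ≤ F.ker := by
    refine Submodule.topologicalClosure_minimal _ (Submodule.span_le.2 ?_) F.isClosed_ker
    rintro p ⟨ψ, hψ, hp1, hp2⟩
    change F p = 0
    have hfd : ∀ (f : EuclideanSpace ℝ (Fin d) → ℝ) (x : EuclideanSpace ℝ (Fin d)),
        gradient f x i = fderiv ℝ f x (EuclideanSpace.single i 1) := by
      intro f x
      rw [← InnerProductSpace.toDual_symm_apply (𝕜 := ℝ), EuclideanSpace.inner_single_right]
      simp [gradient]
    have e1 : ∫ x in Ω, p.fst x * gradient φ x i =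
        ∫ x, ψ x * fderiv ℝ φ x (EuclideanSpace.single i 1) := by
      rw [← setIntegral_eq_integral_of_forall_compl_eq_zero (s := Ω)
        (f := fun x => ψ x * fderiv ℝ φ x (EuclideanSpace.single i 1))]
      · refine integral_congr_ae ?_
        filter_upwards [hp1] with x hx
        rw [hx, hfd]
      · intro x hx
        rw [image_eq_zero_of_notMem_tsupport fun h => hx (hψ.supp h), zero_mul]
    have e2 : ∫ x in Ω, p.snd x i * φ x =
        ∫ x, fderiv ℝ ψ x (EuclideanSpace.single i 1) * φ x := by
      rw [← setIntegral_eq_integral_of_forall_compl_eq_zero (s := Ω)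
        (f := fun x => fderiv ℝ ψ x (EuclideanSpace.single i 1) * φ x)]
      · refine integral_congr_ae ?_
        filter_upwards [hp2] with x hx
        rw [hx, hfd]
      · intro x hx
        rw [image_eq_zero_of_notMem_tsupport fun h => hx (hφ.supp h), mul_zero]
    have cd : ∀ f, IsTest Ω f → Continuous fun x => fderiv ℝ f x (EuclideanSpace.single i 1) :=
      fun f hf => (hf.smooth.continuous_fderiv (by simp)).clm_apply continuous_const
    rw [hF, e1, e2, integral_mul_fderiv_eq_neg_fderiv_mul_of_integrable]
    · simp
    · exact ((cd ψ hψ).mul hφ.smooth.continuous).integrable_of_hasCompactSupport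
        hφ.compact.mul_left
    · exact (hψ.smooth.continuous.mul (cd φ hφ)).integrable_of_hasCompactSupport
        hψ.compact.mul_right
    · exact (hψ.smooth.continuous.mul hφ.smooth.continuous).integrable_of_hasCompactSupport
        hψ.compact.mul_right
    · exact fun x _ => hψ.smooth.differentiable (by simp) x
    · exact fun x _ => hφ.smooth.differentiable (by simp) x
  have h0 : F u = 0 := hle u.2
  rw [hF] at h0
  exact eq_neg_of_add_eq_zero_left h0

/-- The map `u ↦ b · ∇u`, `H₀¹(Ω) → L²(Ω)`, for a bounded vector field `b` on `Ω`. -/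
def advect {Ω : Set (EuclideanSpace ℝ (Fin d))}
    (b : Lp (EuclideanSpace ℝ (Fin d)) ∞ (volume.restrict Ω)) : H10 Ω →L[ℝ] L2 Ω :=
  (ContinuousLinearMap.holderL (volume.restrict Ω) ∞ 2 2
    (innerSL ℝ : EuclideanSpace ℝ (Fin d) →L[ℝ] EuclideanSpace ℝ (Fin d) →L[ℝ] ℝ) b) ∘L grad Ω

theorem advect_ae {Ω : Set (EuclideanSpace ℝ (Fin d))}
    (b : Lp (EuclideanSpace ℝ (Fin d)) ∞ (volume.restrict Ω)) (u : H10 Ω) :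
    advect b u =ᵐ[volume.restrict Ω] fun x => ⟪b x, grad Ω u x⟫ :=
  ContinuousLinearMap.coeFn_holder (r := 2)
    (innerSL ℝ : EuclideanSpace ℝ (Fin d) →L[ℝ] EuclideanSpace ℝ (Fin d) →L[ℝ] ℝ) b (grad Ω u)

/-- `L = (∇, I_X + b · ∇) : H₀¹(Ω) → [L²(Ω)]^d × L²(Ω)`. -/
def opL {Ω : Set (EuclideanSpace ℝ (Fin d))}
    (b : Lp (EuclideanSpace ℝ (Fin d)) ∞ (volume.restrict Ω)) :
    H10 Ω →L[ℝ] WithLp 2 (L2Vec Ω × L2 Ω) :=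
  (WithLp.prodContinuousLinearEquiv 2 ℝ (L2Vec Ω) (L2 Ω)).symm.toContinuousLinearMap ∘L
    (grad Ω).prod (incl Ω + advect b)

/-- `M = (∇, I_X) : H₀¹(Ω) → [L²(Ω)]^d × L²(Ω)`. -/
def opM (Ω : Set (EuclideanSpace ℝ (Fin d))) : H10 Ω →L[ℝ] WithLp 2 (L2Vec Ω × L2 Ω) :=
  (WithLp.prodContinuousLinearEquiv 2 ℝ (L2Vec Ω) (L2 Ω)).symm.toContinuousLinearMap ∘L
    (grad Ω).prod (incl Ω)

theorem form_opL_opM {Ω : Set (EuclideanSpace ℝ (Fin d))}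
    (b : Lp (EuclideanSpace ℝ (Fin d)) ∞ (volume.restrict Ω)) (u v : H10 Ω) :
    form (opL b) (opM Ω) u v =
      ⟪grad Ω u, grad Ω v⟫ + ⟪advect b u, incl Ω v⟫ + ⟪incl Ω u, incl Ω v⟫ := by
  have h : form (opL b) (opM Ω) u v =
      ⟪grad Ω u, grad Ω v⟫ + ⟪incl Ω u + advect b u, incl Ω v⟫ := rfl
  rw [h, inner_add_left]
  ring

end Sobolev

/-! ### The unit square with `b(x, y) = (x/2, y/2)` -/

/-- The open unit square `(0,1)²`. -/
def square : Set (EuclideanSpace ℝ (Fin 2)) := {x | ∀ i, x i ∈ Ioo (0 : ℝ) 1}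

/-- `b(x, y) = (x/2, y/2)`. -/
def field (x : EuclideanSpace ℝ (Fin 2)) : EuclideanSpace ℝ (Fin 2) := !₂[x 0 / 2, x 1 / 2]

theorem isOpen_square : IsOpen square := by
  have h : square = ⋂ i, (fun x : EuclideanSpace ℝ (Fin 2) => x i) ⁻¹' Ioo 0 1 := by
    ext x; simp [square]
  rw [h]
  exact isOpen_iInter_of_finite fun i =>
    isOpen_Ioo.preimage (EuclideanSpace.proj (𝕜 := ℝ) i).continuous

theorem field_eq (x : EuclideanSpace ℝ (Fin 2)) : field x = (1 / 2 : ℝ) • x := by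
  ext i; fin_cases i <;> simp [field] <;> ring

theorem memLp_field : MemLp field ∞ (volume.restrict square) := by
  have hc : Continuous field := by
    rw [funext field_eq]
    exact continuous_const_smul _
  refine memLp_top_of_bound hc.aestronglyMeasurable 1 ?_
  refine (ae_restrict_iff' isOpen_square.measurableSet).2 (Filter.Eventually.of_forall ?_)
  intro x hx
  have h0 := hx 0
  have h1 := hx 1
  rw [EuclideanSpace.norm_eq, Real.sqrt_le_iff]
  refine ⟨zero_le_one, ?_⟩
  simp only [field, Fin.sum_univ_two, Real.norm_eq_abs, sq_abs, PiLp.toLp_apply,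
    Matrix.cons_val_zero, Matrix.cons_val_one]
  nlinarith [h0.1, h0.2, h1.1, h1.2]

/-- `b` as an element of `L^∞` of the unit square. -/
def fieldLp : Lp (EuclideanSpace ℝ (Fin 2)) ∞ (volume.restrict square) := memLp_field.toLp field

/-- `L` for the unit square and `b = (x/2, y/2)`. -/
def sqL : H10 square →L[ℝ] WithLp 2 (L2Vec square × L2 square) := opL fieldLp

/-- `M` for the unit square. -/
def sqM : H10 square →L[ℝ] WithLp 2 (L2Vec square × L2 square) := opM square

/-- `β_{mn} = (m² + n²) π²`. -/
def beta (m n : ℕ) : ℝ := ((m : ℝ) ^ 2 + (n : ℝ) ^ 2) * Real.pi ^ 2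

end AdvDiff

end

/-! Since `div b = 1`, integration by parts gives `(b·∇u, v)₀ + (u, b·∇v)₀ = -(u, v)₀` on `H₀¹`
(`inner_advect_add`). The symmetrized form is therefore `(u, v)_V - ½ (u, v)₀`: the advection
survives only as a zero-order term. Lax–Milgram represents this form by an invertible operator `B =
R_V⁻¹ A` (`symOp`), and `K = B⁻¹`, so every claim becomes a claim about the symmetric operator `B`.

The functions `e_jk = sin(jπx) sin(kπy)` satisfy `(e_jk, v)_V = (1 + β_jk)(e_jk, v)₀`
(`inner_sine`), hence `B e_jk = (1 + 2β_jk)/(2 + 2β_jk) e_jk`. They are orthogonal and total in `V`.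
A symmetric operator with a total family of eigenvectors has no further eigenvalues or eigenvectors,
so no compactness argument is needed. Expansion in this family also bounds the quadratic form below
by the smallest eigenvalue, which belongs to `j = k = 1`; this is the coercivity constant, attained
at `e_11`.

Two analytic facts remain. `e_jk` lies in the closure of the test functions (`sinePair_mem`), by
cutoffs whose gradients stay bounded because the sines vanish on the boundary. The `e_jk` are total
in `L²` (`eq_zero_of_inner_sine`), by Stone–Weierstrass for the algebra generated by `cos(πx)` and
`cos(πy)`; injectivity of `H₀¹ → L²` carries totality to `V`. -/

noncomputable section

namespace AdvDiff

/-! ### Symmetric operators with a total family of eigenvectors -/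

section Spectral

variable {V : Type*} [NormedAddCommGroup V] [InnerProductSpace ℝ V]

/-- A symmetric operator with a total family of eigenvectors `e i` has no other eigenvectors:
each eigenspace is the span of those `e i` it contains. -/
theorem eigenspace_eq_span_of_total {ι : Type*} {T : V →L[ℝ] V}
    (hT : ∀ u v, ⟪T u, v⟫ = ⟪u, T v⟫) {e : ι → V} {μ : ι → ℝ} (he : ∀ i, T (e i) = μ i • e i)
    (htot : ∀ v, (∀ i, ⟪e i, v⟫ = 0) → v = 0) {c : ℝ} (hfin : {i | μ i = c}.Finite) :
    Module.End.eigenspace T.toLinearMap c = Submodule.span ℝ (e '' {i | μ i = c}) := by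
  apply le_antisymm
  · intro u hu
    have hu' : T u = c • u := Module.End.mem_eigenspace_iff.1 hu
    set W := Submodule.span ℝ (e '' {i | μ i = c}) with hW
    have : FiniteDimensional ℝ W := FiniteDimensional.span_of_finite ℝ (hfin.image e)
    have hWT : ∀ w ∈ W, T w = c • w := by
      intro w hw
      have : W ≤ Module.End.eigenspace T.toLinearMap c := by
        rw [hW, Submodule.span_le]
        rintro _ ⟨i, hi, rfl⟩
        exact Module.End.mem_eigenspace_iff.2 (by rw [← show μ i = c from hi]; exact he i)
      exact Module.End.mem_eigenspace_iff.1 (this hw)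
    -- The residual `u - p` is orthogonal to each `e i`: by projection when `μ i = c`, and otherwise
    -- because it satisfies `T (u - p) = c • (u - p)` and `T` is symmetric. Totality then makes it
    -- zero.
    set p : V := W.starProjection u with hp
    have hpW : p ∈ W := W.starProjection_apply_mem u
    have hz : u - p = 0 := by
      refine htot _ fun i => ?_
      by_cases hi : μ i = c
      · exact W.sub_starProjection_mem_orthogonal u _ (Submodule.subset_span ⟨i, hi, rfl⟩)
      · have h1 := hT (e i) (u - p)
        rw [he, map_sub, hu', hWT p hpW, ← smul_sub, real_inner_smul_left,
          real_inner_smul_right] at h1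
        have h2 : (μ i - c) * ⟪e i, u - p⟫ = 0 := by linarith
        exact (mul_eq_zero.1 h2).resolve_left (sub_ne_zero.2 hi)
    rw [sub_eq_zero.1 hz]
    exact hpW
  · rw [Submodule.span_le]
    rintro _ ⟨i, hi, rfl⟩
    exact Module.End.mem_eigenspace_iff.2 (by rw [← show μ i = c from hi]; exact he i)

/-- The eigenvalues of a symmetric operator with a total family of eigenvectors. -/
theorem hasEigenvalue_iff_of_total {ι : Type*} {T : V →L[ℝ] V}
    (hT : ∀ u v, ⟪T u, v⟫ = ⟪u, T v⟫) {e : ι → V} {μ : ι → ℝ} (he : ∀ i, T (e i) = μ i • e i)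
    (hne : ∀ i, e i ≠ 0) (htot : ∀ v, (∀ i, ⟪e i, v⟫ = 0) → v = 0) {c : ℝ} :
    Module.End.HasEigenvalue T.toLinearMap c ↔ ∃ i, μ i = c := by
  constructor
  · intro h
    by_contra! hc
    obtain ⟨u, hu, hu0⟩ := h.exists_hasEigenvector
    have hu' : T u = c • u := Module.End.mem_eigenspace_iff.1 hu
    refine hu0 (htot u fun i => ?_)
    have h1 := hT (e i) u
    rw [he, hu', real_inner_smul_left, real_inner_smul_right] at h1
    have h2 : (μ i - c) * ⟪e i, u⟫ = 0 := by linarith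
    exact (mul_eq_zero.1 h2).resolve_left (sub_ne_zero.2 (hc i))
  · rintro ⟨i, rfl⟩
    exact Module.End.hasEigenvalue_of_hasEigenvector
      ⟨Module.End.mem_eigenspace_iff.2 (he i), hne i⟩

/-- A lower bound for the eigenvalues is a lower bound for the quadratic form. -/
theorem mul_norm_sq_le_inner_of_total [CompleteSpace V] {ι : Type*} {T : V →L[ℝ] V}
    (hT : ∀ u v, ⟪T u, v⟫ = ⟪u, T v⟫) {e : ι → V} {μ : ι → ℝ} (he : ∀ i, T (e i) = μ i • e i)
    (hne : ∀ i, e i ≠ 0) (horth : ∀ i j, i ≠ j → ⟪e i, e j⟫ = 0)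
    (htot : ∀ v, (∀ i, ⟪e i, v⟫ = 0) → v = 0) {m : ℝ} (hm : ∀ i, m ≤ μ i) (u : V) :
    m * ‖u‖ ^ 2 ≤ ⟪T u, u⟫ := by
  have hne' : ∀ i, ‖e i‖ ≠ 0 := fun i => norm_ne_zero_iff.2 (hne i)
  set f : ι → V := fun i => ‖e i‖⁻¹ • e i with hf
  have hfo : Orthonormal ℝ f := by
    refine ⟨fun i => ?_, fun i j hij => ?_⟩
    · rw [hf]
      simp [norm_smul, hne' i]
    · simp only [hf]
      rw [real_inner_smul_left, real_inner_smul_right, horth i j hij]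
      simp
  have hft : (Submodule.span ℝ (range f))ᗮ = ⊥ := by
    rw [eq_bot_iff]
    intro v hv
    refine htot v fun i => ?_
    have h1 : ⟪f i, v⟫ = 0 := hv _ (Submodule.subset_span ⟨i, rfl⟩)
    simp only [hf] at h1
    rw [real_inner_smul_left] at h1
    exact (mul_eq_zero.1 h1).resolve_left (inv_ne_zero (hne' i))
  let b := HilbertBasis.mkOfOrthogonalEqBot hfo hft
  have hb : ∀ i, b i = f i := fun i => by simp [b]
  have hTb : ∀ i, T (b i) = μ i • b i := fun i => by
    rw [hb]
    simp only [hf]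
    rw [map_smul, he, smul_comm]
  -- Parseval turns both sides into series in `⟪b i, u⟫ ^ 2`, with coefficients `m` and `μ i`, which
  -- are compared term by term.
  have s1 := (b.hasSum_inner_mul_inner u u).mul_left m
  have s2 := b.hasSum_inner_mul_inner (T u) u
  rw [real_inner_self_eq_norm_sq] at s1
  refine hasSum_le (fun i => ?_) s1 s2
  rw [hT, hTb, real_inner_smul_right, real_inner_comm u (b i)]
  nlinarith [hm i, mul_self_nonneg ⟪b i, u⟫]

end Spectral

/-! ### Reduction of `A`, `K` and `C` to a Riesz-represented operator `B` -/

section Symmetrized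

variable {V Y : Type*} [NormedAddCommGroup V] [InnerProductSpace ℝ V] [CompleteSpace V]
  [NormedAddCommGroup Y] [InnerProductSpace ℝ Y] {L M : V →L[ℝ] Y} {B : V ≃L[ℝ] V}

theorem opA_eq_of_inner
    (h : ∀ u v, (1 / 2 : ℝ) * (⟪L u, M v⟫ + ⟪M u, L v⟫) = ⟪B u, v⟫) :
    opA L M = ((B.trans (InnerProductSpace.toDual ℝ V).toContinuousLinearEquiv :
      V ≃L[ℝ] StrongDual ℝ V) : V →L[ℝ] StrongDual ℝ V) := by
  ext u v
  exact h u v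

/-- `A = R_V B` gives `K = (R_V B)⁻¹ R_V = B⁻¹`: the Riesz map cancels, and spectral questions about
`K` pass to `B`, whose bilinear form is explicit. -/
theorem opK_eq_of_inner
    (h : ∀ u v, (1 / 2 : ℝ) * (⟪L u, M v⟫ + ⟪M u, L v⟫) = ⟪B u, v⟫) :
    opK L M = (B.symm : V →L[ℝ] V) := by
  rw [opK, opA_eq_of_inner h, ContinuousLinearMap.inverse_equiv]
  ext u
  change B.symm ((InnerProductSpace.toDual ℝ V).symm (InnerProductSpace.toDual ℝ V u)) = B.symm u
  simp

theorem eigenspace_opK_of_inner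
    (h : ∀ u v, (1 / 2 : ℝ) * (⟪L u, M v⟫ + ⟪M u, L v⟫) = ⟪B u, v⟫) {κ : ℝ} (hκ : κ ≠ 0) :
    Module.End.eigenspace (opK L M).toLinearMap κ =
      Module.End.eigenspace (B : V →L[ℝ] V).toLinearMap κ⁻¹ := by
  ext u
  rw [Module.End.mem_eigenspace_iff, Module.End.mem_eigenspace_iff, opK_eq_of_inner h]
  change B.symm u = κ • u ↔ B u = κ⁻¹ • u
  rw [ContinuousLinearEquiv.symm_apply_eq, map_smul, eq_comm, eq_inv_smul_iff₀ hκ]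

theorem eigenspace_opK_zero_of_inner
    (h : ∀ u v, (1 / 2 : ℝ) * (⟪L u, M v⟫ + ⟪M u, L v⟫) = ⟪B u, v⟫) :
    Module.End.eigenspace (opK L M).toLinearMap 0 = ⊥ := by
  rw [eq_bot_iff]
  intro u hu
  rw [Module.End.mem_eigenspace_iff, opK_eq_of_inner h, zero_smul] at hu
  exact B.symm.map_eq_zero_iff.1 hu

/-- `(u, v) - (J u, J v) / 2` is represented by an invertible operator if `J` is a contraction. -/
theorem exists_equiv_inner_sub_half {J : V →L[ℝ] Y} (hJ : ∀ u, ‖J u‖ ≤ ‖u‖) :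
    ∃ S : V ≃L[ℝ] V, ∀ u v, ⟪S u, v⟫ = ⟪u, v⟫ - 1 / 2 * ⟪J u, J v⟫ := by
  let a : V →L[ℝ] V →L[ℝ] ℝ := rieszMap V - (1 / 2 : ℝ) • pivotAdjoint J ∘L J
  have ha : ∀ u v, a u v = ⟪u, v⟫ - 1 / 2 * ⟪J u, J v⟫ := fun _ _ => rfl
  have hco : IsCoercive a := by
    -- The constant comes from `‖u‖² - ½ ‖J u‖² ≥ ½ ‖u‖²`; Lax–Milgram then supplies the operator.
    refine ⟨1 / 2, by norm_num, fun u => ?_⟩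
    have h1 := pow_le_pow_left₀ (norm_nonneg _) (hJ u) 2
    rw [ha, mul_assoc, real_inner_self_eq_norm_sq, real_inner_self_eq_norm_sq, ← pow_two]
    linarith
  exact ⟨hco.continuousLinearEquivOfBilin, hco.continuousLinearEquivOfBilin_apply⟩

end Symmetrized

theorem eigenspace_opC {V Y : Type*} [NormedAddCommGroup V] [InnerProductSpace ℝ V]
    [NormedAddCommGroup Y] [InnerProductSpace ℝ Y] (L M : V →L[ℝ] Y) (c : ℝ) :
    Module.End.eigenspace (opC L M).toLinearMap c =
      Module.End.eigenspace (opK L M).toLinearMap (1 + c) := by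
  ext u
  rw [Module.End.mem_eigenspace_iff, Module.End.mem_eigenspace_iff, add_smul, one_smul]
  change opK L M u - u = c • u ↔ opK L M u = u + c • u
  rw [sub_eq_iff_eq_add, add_comm]

/-! ### Tools for `H₀¹(Ω)`: density, integration by parts, membership by limits -/

section Sobolev

variable {d : ℕ} {Ω : Set (EuclideanSpace ℝ (Fin d))}

theorem gradient_apply (f : EuclideanSpace ℝ (Fin d) → ℝ) (x : EuclideanSpace ℝ (Fin d))
    (i : Fin d) : gradient f x i = fderiv ℝ f x (EuclideanSpace.single i 1) := by
  rw [← InnerProductSpace.toDual_symm_apply (𝕜 := ℝ), EuclideanSpace.inner_single_right]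
  simp [gradient]

theorem continuous_gradient {f : EuclideanSpace ℝ (Fin d) → ℝ} (hf : ContDiff ℝ ∞ f) :
    Continuous (gradient f) :=
  (InnerProductSpace.toDual ℝ _).symm.continuous.comp (hf.continuous_fderiv (by simp))

theorem continuous_partial {f : EuclideanSpace ℝ (Fin d) → ℝ} (hf : ContDiff ℝ ∞ f) (i : Fin d) :
    Continuous fun x => fderiv ℝ f x (EuclideanSpace.single i 1) :=
  (hf.continuous_fderiv (by simp)).clm_apply continuous_const

namespace IsTest

variable {φ : EuclideanSpace ℝ (Fin d) → ℝ}

theorem memLp (h : IsTest Ω φ) : MemLp φ 2 (volume.restrict Ω) :=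
  (h.smooth.continuous.memLp_of_hasCompactSupport h.compact).restrict Ω

theorem memLp_gradient (h : IsTest Ω φ) : MemLp (gradient φ) 2 (volume.restrict Ω) :=
  ((continuous_gradient h.smooth).memLp_of_hasCompactSupport
    ((h.compact.fderiv ℝ).comp_left (map_zero _))).restrict Ω

theorem eq_zero_of_notMem (h : IsTest Ω φ) {x : EuclideanSpace ℝ (Fin d)} (hx : x ∉ Ω) :
    φ x = 0 :=
  image_eq_zero_of_notMem_tsupport fun hx' => hx (h.supp hx')

theorem fderiv_eq_zero_of_notMem (h : IsTest Ω φ) {x : EuclideanSpace ℝ (Fin d)} (hx : x ∉ Ω) :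
    fderiv ℝ φ x = 0 :=
  image_eq_zero_of_notMem_tsupport fun hx' => hx (h.supp (tsupport_fderiv_subset ℝ hx'))

/-- The product of a test function and a smooth function is a test function. -/
theorem smooth_mul (h : IsTest Ω φ) {w : EuclideanSpace ℝ (Fin d) → ℝ} (hw : ContDiff ℝ ∞ w) :
    IsTest Ω fun x => w x * φ x :=
  ⟨hw.mul h.smooth, h.compact.mul_left, (tsupport_mul_subset_right).trans h.supp⟩

/-- The pair `(φ, ∇φ)`. -/
def pair (h : IsTest Ω φ) : WithLp 2 (L2 Ω × L2Vec Ω) :=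
  WithLp.toLp 2 (h.memLp.toLp φ, h.memLp_gradient.toLp (gradient φ))

theorem pair_mem (h : IsTest Ω φ) : h.pair ∈ testPairs Ω :=
  ⟨φ, h, h.memLp.coeFn_toLp, h.memLp_gradient.coeFn_toLp⟩

/-- A test function as an element of `H₀¹(Ω)`. -/
def toH10 (h : IsTest Ω φ) : H10 Ω :=
  ⟨h.pair, Submodule.le_topologicalClosure _ (Submodule.subset_span h.pair_mem)⟩

theorem incl_toH10 (h : IsTest Ω φ) : incl Ω h.toH10 =ᵐ[volume.restrict Ω] φ :=
  h.memLp.coeFn_toLp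

theorem grad_toH10 (h : IsTest Ω φ) : grad Ω h.toH10 =ᵐ[volume.restrict Ω] gradient φ :=
  h.memLp_gradient.coeFn_toLp

end IsTest

/-- Continuous functionals on `H₀¹(Ω)` that agree on test functions are equal. -/
theorem H10_functional_ext {F G : H10 Ω →L[ℝ] ℝ}
    (h : ∀ φ, ∀ hφ : IsTest Ω φ, F hφ.toH10 = G hφ.toH10) : F = G := by
  -- The Riesz representative extends `F - G` to the ambient product space. There its kernel is
  -- closed and contains the test pairs, hence contains their closed span.
  obtain ⟨a, ha⟩ := (InnerProductSpace.toDual ℝ (H10 Ω)).surjective (F - G)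
  have ha' : ∀ u : H10 Ω, ⟪(a : WithLp 2 (L2 Ω × L2Vec Ω)), (u : WithLp 2 (L2 Ω × L2Vec Ω))⟫ =
      F u - G u := fun u => by
    rw [show F u - G u = (F - G) u from rfl, ← ha]
    rfl
  have hle : H10 Ω ≤ (innerSL ℝ (a : WithLp 2 (L2 Ω × L2Vec Ω))).ker := by
    refine Submodule.topologicalClosure_minimal _ (Submodule.span_le.2 ?_)
      (ContinuousLinearMap.isClosed_ker _)
    rintro p ⟨φ, hφ, hp1, hp2⟩
    have hp : p = hφ.pair := by
      apply (WithLp.equiv 2 (L2 Ω × L2Vec Ω)).injective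
      refine Prod.ext ?_ ?_
      · exact Lp.ext (hp1.trans hφ.memLp.coeFn_toLp.symm)
      · exact Lp.ext (hp2.trans hφ.memLp_gradient.coeFn_toLp.symm)
    change ⟪(a : WithLp 2 (L2 Ω × L2Vec Ω)), p⟫ = 0
    rw [hp]
    exact (ha' hφ.toH10).trans (by rw [h, sub_self])
  ext u
  have h0 : ⟪(a : WithLp 2 (L2 Ω × L2Vec Ω)), (u : WithLp 2 (L2 Ω × L2Vec Ω))⟫ = 0 := hle u.2
  rw [ha'] at h0
  exact sub_eq_zero.1 h0

theorem inner_L2_eq_integral (f g : L2 Ω) : ⟪f, g⟫ = ∫ x in Ω, f x * g x := by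
  rw [MeasureTheory.L2.inner_def]
  exact integral_congr_ae (Filter.Eventually.of_forall fun x => by simp [mul_comm])

theorem memLp_coord {g : EuclideanSpace ℝ (Fin d) → EuclideanSpace ℝ (Fin d)}
    (hg : MemLp g 2 (volume.restrict Ω)) (i : Fin d) :
    MemLp (fun x => g x i) 2 (volume.restrict Ω) :=
  (EuclideanSpace.proj (𝕜 := ℝ) i).comp_memLp' hg

theorem inner_L2Vec_eq_sum (f g : L2Vec Ω) : ⟪f, g⟫ = ∑ i, ∫ x in Ω, f x i * g x i := by
  rw [MeasureTheory.L2.inner_def, ← integral_finsetSum]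
  · exact integral_congr_ae (Filter.Eventually.of_forall fun x => by
      simp [PiLp.inner_apply, mul_comm])
  · intro i _
    exact (memLp_coord (Lp.memLp f) i).integrable_mul (memLp_coord (Lp.memLp g) i)

/-- Integration by parts in `H₀¹(Ω)` against smooth functions that need not vanish on the
boundary. -/
theorem integral_incl_mul_partial {w : EuclideanSpace ℝ (Fin d) → ℝ} (hw : ContDiff ℝ ∞ w)
    (i : Fin d) (h1 : MemLp w 2 (volume.restrict Ω))
    (h2 : MemLp (fun x => fderiv ℝ w x (EuclideanSpace.single i 1)) 2 (volume.restrict Ω))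
    (v : H10 Ω) :
    ∫ x in Ω, incl Ω v x * fderiv ℝ w x (EuclideanSpace.single i 1) =
      -∫ x in Ω, grad Ω v x i * w x := by
  have h3 : MemLp (fun x => w x • EuclideanSpace.single i (1 : ℝ)) 2 (volume.restrict Ω) :=
    (ContinuousLinearMap.toSpanSingleton ℝ (EuclideanSpace.single i (1 : ℝ))).comp_memLp' h1
  have k1 : ∀ f : L2 Ω, ⟪h2.toLp _, f⟫ =
      ∫ x in Ω, f x * fderiv ℝ w x (EuclideanSpace.single i 1) := by
    intro f
    rw [MeasureTheory.L2.inner_def]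
    refine integral_congr_ae ?_
    filter_upwards [h2.coeFn_toLp] with x hx
    rw [hx]; simp
  have k2 : ∀ f : L2Vec Ω, ⟪h3.toLp _, f⟫ = ∫ x in Ω, f x i * w x := by
    intro f
    rw [MeasureTheory.L2.inner_def]
    refine integral_congr_ae ?_
    filter_upwards [h3.coeFn_toLp] with x hx
    rw [hx, real_inner_smul_left, EuclideanSpace.inner_single_left]
    simp [mul_comm]
  -- Both sides are continuous in `v`, so test functions suffice. For these the integrals extend to
  -- the whole space and compact support leaves no boundary term.
  have key : innerSL ℝ (h2.toLp _) ∘L incl Ω = -(innerSL ℝ (h3.toLp _) ∘L grad Ω) := by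
    refine H10_functional_ext fun φ hφ => ?_
    change ⟪h2.toLp _, incl Ω hφ.toH10⟫ = -⟪h3.toLp _, grad Ω hφ.toH10⟫
    rw [k1, k2]
    have e1 : ∫ x in Ω, incl Ω hφ.toH10 x * fderiv ℝ w x (EuclideanSpace.single i 1) =
        ∫ x, φ x * fderiv ℝ w x (EuclideanSpace.single i 1) := by
      rw [← setIntegral_eq_integral_of_forall_compl_eq_zero (s := Ω)
        (f := fun x => φ x * fderiv ℝ w x (EuclideanSpace.single i 1))]
      · refine integral_congr_ae ?_
        filter_upwards [hφ.incl_toH10] with x hx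
        rw [hx]
      · intro x hx
        rw [hφ.eq_zero_of_notMem hx, zero_mul]
    have e2 : ∫ x in Ω, grad Ω hφ.toH10 x i * w x =
        ∫ x, fderiv ℝ φ x (EuclideanSpace.single i 1) * w x := by
      rw [← setIntegral_eq_integral_of_forall_compl_eq_zero (s := Ω)
        (f := fun x => fderiv ℝ φ x (EuclideanSpace.single i 1) * w x)]
      · refine integral_congr_ae ?_
        filter_upwards [hφ.grad_toH10] with x hx
        rw [hx, gradient_apply]
      · intro x hx
        simp [hφ.fderiv_eq_zero_of_notMem hx]
    rw [e1, e2, integral_mul_fderiv_eq_neg_fderiv_mul_of_integrable]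
    · exact ((continuous_partial hφ.smooth i).mul
        hw.continuous).integrable_of_hasCompactSupport
        ((hφ.compact.fderiv_apply ℝ _).mul_right)
    · exact (hφ.smooth.continuous.mul (continuous_partial hw i)).integrable_of_hasCompactSupport
        hφ.compact.mul_right
    · exact (hφ.smooth.continuous.mul hw.continuous).integrable_of_hasCompactSupport
        hφ.compact.mul_right
    · exact fun x _ => hφ.smooth.differentiable (by simp) x
    · exact fun x _ => hw.differentiable (by simp) x
  have h0 := DFunLike.congr_fun key v
  rw [← k1, ← k2]
  exact h0

theorem norm_incl_le (u : H10 Ω) : ‖incl Ω u‖ ≤ ‖u‖ := by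
  have h1 : (0 : ℝ) ≤ ⟪grad Ω u, grad Ω u⟫ := real_inner_self_nonneg
  have h2 := inner_H10 u u
  rw [real_inner_self_eq_norm_sq, real_inner_self_eq_norm_sq] at h2
  exact (sq_le_sq₀ (norm_nonneg _) (norm_nonneg _)).1 (by linarith)

/-- The inclusion of `H₀¹(Ω)` in `L²(Ω)` is injective. -/
theorem incl_injective (hΩ : IsOpen Ω) (u : H10 Ω) (hu : incl Ω u = 0) : u = 0 := by
  have hcoord : ∀ i, ∀ᵐ x ∂volume.restrict Ω, grad Ω u x i = 0 := by
    intro i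
    rw [ae_restrict_iff' hΩ.measurableSet]
    have hi := memLp_coord (Lp.memLp (grad Ω u)) i
    -- With `u = 0` in `L²`, the weak gradient identity says that each component of the gradient
    -- integrates to zero against every test function.
    refine hΩ.ae_eq_zero_of_integral_contDiff_smul_eq_zero
      (locallyIntegrableOn_of_locallyIntegrable_restrict
        (hi.locallyIntegrable (by norm_num))) ?_
    intro φ hφ hc hs
    have hw := isWeakGradient_grad u φ ⟨hφ, hc, hs⟩ i
    have h0 : ∫ x in Ω, incl Ω u x * gradient φ x i = 0 := by
      refine integral_eq_zero_of_ae ?_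
      rw [hu]
      filter_upwards [Lp.coeFn_zero ℝ 2 (volume.restrict Ω)] with x hx
      rw [hx]; simp
    rw [h0, eq_comm, neg_eq_zero] at hw
    rw [← hw, ← setIntegral_eq_integral_of_forall_compl_eq_zero (s := Ω)]
    · simp [mul_comm]
    · intro x hx
      rw [image_eq_zero_of_notMem_tsupport fun h => hx (hs h), zero_smul]
  have hg : grad Ω u = 0 := by
    refine Lp.ext ?_
    filter_upwards [ae_all_iff.2 hcoord, Lp.coeFn_zero (EuclideanSpace ℝ (Fin d)) 2
      (volume.restrict Ω)] with x hx h0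
    rw [h0]
    ext i
    exact hx i
  have hn : ⟪u, u⟫ = 0 := by rw [inner_H10, hu, hg]; simp
  exact inner_self_eq_zero.1 hn

/-- Pointwise limits of test functions, with bounded values and gradients, are in `H₀¹(Ω)`. -/
theorem mem_H10_of_tendsto [IsFiniteMeasure (volume.restrict Ω)] (hΩ : MeasurableSet Ω)
    {φ : ℕ → EuclideanSpace ℝ (Fin d) → ℝ} (hφ : ∀ n, IsTest Ω (φ n))
    {p : WithLp 2 (L2 Ω × L2Vec Ω)} {C : ℝ} (hb : ∀ n, ∀ x ∈ Ω, ‖φ n x‖ ≤ C)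
    (hb' : ∀ n, ∀ x ∈ Ω, ‖gradient (φ n) x‖ ≤ C)
    (ht : ∀ᵐ x ∂volume.restrict Ω,
      Filter.Tendsto (fun n => φ n x) Filter.atTop (nhds (p.fst x)))
    (ht' : ∀ᵐ x ∂volume.restrict Ω,
      Filter.Tendsto (fun n => gradient (φ n) x) Filter.atTop (nhds (p.snd x))) :
    p ∈ H10 Ω := by
  have hcl : IsClosed (H10 Ω : Set (WithLp 2 (L2 Ω × L2Vec Ω))) :=
    Submodule.isClosed_topologicalClosure _
  -- A closed subspace is its own double orthogonal complement, so weak convergence of the pairs `(φ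
  -- n, ∇φ n)` is enough; it follows from dominated convergence against each fixed `q`.
  rw [← hcl.submodule_topologicalClosure_eq, ← Submodule.orthogonal_orthogonal_eq_closure,
    Submodule.mem_orthogonal]
  intro q hq
  have h0 : ∀ n, (∫ x in Ω, ⟪q.fst x, φ n x⟫) + ∫ x in Ω, ⟪q.snd x, gradient (φ n) x⟫ = 0 := by
    intro n
    have := (Submodule.mem_orthogonal' _ _).1 hq _ (hφ n).toH10.2
    rw [WithLp.prod_inner_apply, MeasureTheory.L2.inner_def, MeasureTheory.L2.inner_def] at this
    rw [← this]
    congr 1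
    · refine integral_congr_ae ?_
      filter_upwards [(hφ n).incl_toH10] with x hx
      rw [← hx]; rfl
    · refine integral_congr_ae ?_
      filter_upwards [(hφ n).grad_toH10] with x hx
      rw [← hx]; rfl
  have hi1 : Integrable (fun x => q.fst x) (volume.restrict Ω) :=
    (Lp.memLp q.fst).integrable (by norm_num)
  have hi2 : Integrable (fun x => q.snd x) (volume.restrict Ω) :=
    (Lp.memLp q.snd).integrable (by norm_num)
  have l1 : Filter.Tendsto (fun n => ∫ x in Ω, ⟪q.fst x, φ n x⟫) Filter.atTop
      (nhds (∫ x in Ω, ⟪q.fst x, p.fst x⟫)) := by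
    refine tendsto_integral_of_dominated_convergence (fun x => ‖q.fst x‖ * C) ?_
      (hi1.norm.mul_const C) ?_ ?_
    · exact fun n => hi1.aestronglyMeasurable.inner
        (hφ n).smooth.continuous.aestronglyMeasurable
    · intro n
      refine (ae_restrict_iff' hΩ).2 (Filter.Eventually.of_forall fun x hx => ?_)
      exact (norm_inner_le_norm _ _).trans (mul_le_mul_of_nonneg_left (hb n x hx) (norm_nonneg _))
    · filter_upwards [ht] with x hx
      exact tendsto_const_nhds.inner hx
  have l2 : Filter.Tendsto (fun n => ∫ x in Ω, ⟪q.snd x, gradient (φ n) x⟫) Filter.atTop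
      (nhds (∫ x in Ω, ⟪q.snd x, p.snd x⟫)) := by
    refine tendsto_integral_of_dominated_convergence (fun x => ‖q.snd x‖ * C) ?_
      (hi2.norm.mul_const C) ?_ ?_
    · exact fun n => hi2.aestronglyMeasurable.inner
        (continuous_gradient (hφ n).smooth).aestronglyMeasurable
    · intro n
      refine (ae_restrict_iff' hΩ).2 (Filter.Eventually.of_forall fun x hx => ?_)
      exact (norm_inner_le_norm _ _).trans (mul_le_mul_of_nonneg_left (hb' n x hx) (norm_nonneg _))
    · filter_upwards [ht'] with x hx
      exact tendsto_const_nhds.inner hx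
  have l3 := l1.add l2
  simp only [h0] at l3
  rw [WithLp.prod_inner_apply, MeasureTheory.L2.inner_def, MeasureTheory.L2.inner_def]
  exact (tendsto_nhds_unique l3 tendsto_const_nhds)

end Sobolev

/-! ### One-dimensional sines cut off near the endpoints -/

section Cutoff

/-- A smooth cutoff that vanishes where `n t (1 - t) ≤ 1`. -/
def cutoff (n : ℕ) (t : ℝ) : ℝ := Real.smoothTransition (n * (t * (1 - t)) - 1)

/-- `sin(kπt)`, cut off near the boundary of `(0,1)`. -/
def cutSine (k n : ℕ) (t : ℝ) : ℝ := cutoff n t * Real.sin (k * Real.pi * t)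

theorem contDiff_cutoff (n : ℕ) : ContDiff ℝ ∞ (cutoff n) :=
  Real.smoothTransition.contDiff.comp (by fun_prop)

theorem contDiff_sine (k : ℕ) : ContDiff ℝ ∞ fun t : ℝ => Real.sin (k * Real.pi * t) :=
  Real.contDiff_sin.comp (by fun_prop)

theorem contDiff_cutSine (k n : ℕ) : ContDiff ℝ ∞ (cutSine k n) :=
  (contDiff_cutoff n).mul (contDiff_sine k)

theorem cutSine_eq_zero {k n : ℕ} {t : ℝ} (h : n * (t * (1 - t)) < 1) : cutSine k n t = 0 := by
  rw [cutSine, cutoff, Real.smoothTransition.zero_of_nonpos (by linarith), zero_mul]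

theorem deriv_sine (k : ℕ) (t : ℝ) :
    HasDerivAt (fun t : ℝ => Real.sin (k * Real.pi * t))
      (k * Real.pi * Real.cos (k * Real.pi * t)) t := by
  have h := ((hasDerivAt_id t).const_mul ((k : ℝ) * Real.pi)).sin
  simp only [id, mul_one] at h
  convert h using 1
  ring

theorem deriv_cosine (k : ℕ) (t : ℝ) :
    HasDerivAt (fun t : ℝ => Real.cos (k * Real.pi * t))
      (-(k * Real.pi * Real.sin (k * Real.pi * t))) t := by
  have h := ((hasDerivAt_id t).const_mul ((k : ℝ) * Real.pi)).cos
  simp only [id, mul_one] at h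
  convert h using 1
  ring

/-- The sine vanishes at both endpoints because `k` is an integer, so it is at most `kπ min(t, 1 -
t)`, and `min(t, 1 - t) ≤ 2t(1 - t)`. This decay compensates the steep slope of the cutoff. -/
theorem abs_sine_le (k : ℕ) {t : ℝ} (ht : t ∈ Ioo (0 : ℝ) 1) :
    |Real.sin (k * Real.pi * t)| ≤ 2 * (k * Real.pi) * (t * (1 - t)) := by
  have hk : 0 ≤ (k : ℝ) * Real.pi := by positivity
  have h1 : |Real.sin (k * Real.pi * t)| ≤ k * Real.pi * t := by
    refine (Real.abs_sin_le_abs).trans (le_of_eq (abs_of_nonneg (mul_nonneg hk ht.1.le)))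
  have h2 : |Real.sin (k * Real.pi * t)| ≤ k * Real.pi * (1 - t) := by
    have h3 : |Real.sin (k * Real.pi * t)| ≤ |Real.sin (k * Real.pi * (1 - t))| := by
      conv_lhs => rw [show (k : ℝ) * Real.pi * t = k * Real.pi - k * Real.pi * (1 - t) by ring, Real.sin_sub,
        Real.sin_nat_mul_pi, zero_mul, zero_sub, abs_neg, abs_mul]
      exact mul_le_of_le_one_left (abs_nonneg _) (Real.abs_cos_le_one _)
    exact h3.trans <| (Real.abs_sin_le_abs).trans
      (le_of_eq (abs_of_nonneg (mul_nonneg hk (by linarith [ht.2]))))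
  rcases le_total t (1 / 2) with h | h
  · refine h1.trans ?_
    nlinarith [mul_nonneg (mul_nonneg hk ht.1.le) (by linarith : (0 : ℝ) ≤ 1 - 2 * t)]
  · refine h2.trans ?_
    nlinarith [mul_nonneg (mul_nonneg hk (by linarith [ht.2] : (0 : ℝ) ≤ 1 - t))
      (by linarith : (0 : ℝ) ≤ 2 * t - 1)]

/-- The derivative of the smooth transition is bounded and supported in `[0, 1]`. -/
theorem exists_bound_deriv_smoothTransition :
    ∃ M, 0 ≤ M ∧ ∀ y, |deriv Real.smoothTransition y| * |y + 1| ≤ M := by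
  have hc : Continuous (deriv Real.smoothTransition) :=
    (Real.smoothTransition.contDiff (n := 1)).continuous_deriv le_rfl
  obtain ⟨M, hM⟩ := isCompact_Icc.exists_bound_of_continuousOn (s := Icc (0 : ℝ) 1)
    (f := fun y => deriv Real.smoothTransition y * (y + 1)) (by fun_prop)
  have hM0 : 0 ≤ M := (norm_nonneg _).trans (hM 0 ⟨le_rfl, zero_le_one⟩)
  refine ⟨M, hM0, fun y => ?_⟩
  by_cases hy : y ∈ Icc (0 : ℝ) 1
  · rw [← abs_mul]; exact hM y hy
  · have h0 : deriv Real.smoothTransition y = 0 := by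
      rcases not_and_or.1 hy with h | h
      · have : Real.smoothTransition =ᶠ[nhds y] fun _ => 0 := by
          filter_upwards [Iio_mem_nhds (not_le.1 h)] with z hz
          exact Real.smoothTransition.zero_of_nonpos (le_of_lt hz)
        rw [this.deriv_eq, deriv_const]
      · have : Real.smoothTransition =ᶠ[nhds y] fun _ => 1 := by
          filter_upwards [Ioi_mem_nhds (not_le.1 h)] with z hz
          exact Real.smoothTransition.one_of_one_le (le_of_lt hz)
        rw [this.deriv_eq, deriv_const]
    rw [h0, abs_zero, zero_mul]
    exact hM0

theorem hasDerivAt_cutoff (n : ℕ) (t : ℝ) :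
    HasDerivAt (cutoff n)
      (deriv Real.smoothTransition (n * (t * (1 - t)) - 1) * (n * (1 - 2 * t))) t := by
  have h1 : HasDerivAt (fun t : ℝ => n * (t * (1 - t)) - 1) (n * (1 - 2 * t)) t := by
    refine ((((hasDerivAt_id t).mul ((hasDerivAt_id t).const_sub 1)).const_mul
      (n : ℝ)).sub_const 1).congr_deriv ?_
    simp only [id]
    ring
  have h2 : HasDerivAt Real.smoothTransition _ (n * (t * (1 - t)) - 1) :=
    ((Real.smoothTransition.contDiff (n := 1)).differentiable (by simp) _).hasDerivAt
  exact h2.comp t h1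

theorem abs_cutoff_le (n : ℕ) (t : ℝ) : |cutoff n t| ≤ 1 := by
  rw [cutoff, abs_of_nonneg (Real.smoothTransition.nonneg _)]
  exact Real.smoothTransition.le_one _

theorem abs_cutSine_le (k n : ℕ) (t : ℝ) : |cutSine k n t| ≤ 1 := by
  rw [cutSine, abs_mul]
  exact mul_le_one₀ (abs_cutoff_le n t) (abs_nonneg _) (Real.abs_sin_le_one _)

/-- The point is uniformity in `n`. The cutoff has slope of order `n`, but the sine contributes a
factor of order `t(1 - t)`, and `n t(1 - t)` stays bounded wherever the slope is nonzero. -/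
theorem exists_bound_deriv_cutSine (k : ℕ) :
    ∃ C, 0 ≤ C ∧ ∀ n, ∀ t ∈ Ioo (0 : ℝ) 1, |deriv (cutSine k n) t| ≤ C := by
  obtain ⟨M, hM0, hM⟩ := exists_bound_deriv_smoothTransition
  have hk : 0 ≤ (k : ℝ) * Real.pi := by positivity
  refine ⟨M * (2 * (k * Real.pi)) + k * Real.pi, by positivity, fun n t ht => ?_⟩
  have hs : 0 < t * (1 - t) := mul_pos ht.1 (by linarith [ht.2])
  have hd : HasDerivAt (cutSine k n) _ t := (hasDerivAt_cutoff n t).mul (deriv_sine k t)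
  rw [hd.deriv]
  refine (abs_add_le _ _).trans (add_le_add ?_ ?_)
  · have h1 := hM (n * (t * (1 - t)) - 1)
    -- At `y = n t(1 - t) - 1` the weight `|y + 1|` is exactly `n t(1 - t)`.
    rw [sub_add_cancel, abs_of_nonneg (by positivity : 0 ≤ (n : ℝ) * (t * (1 - t)))] at h1
    have h2 : |1 - 2 * t| ≤ 1 := abs_le.2 ⟨by linarith [ht.2], by linarith [ht.1]⟩
    have h3 := abs_sine_le k ht
    rw [abs_mul, abs_mul, abs_mul, Nat.abs_cast]
    set D := |deriv Real.smoothTransition (n * (t * (1 - t)) - 1)|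
    have hD : 0 ≤ D := abs_nonneg _
    calc D * (n * |1 - 2 * t|) * |Real.sin (k * Real.pi * t)|
        ≤ D * (n * 1) * (2 * (k * Real.pi) * (t * (1 - t))) := by gcongr
      _ = D * (n * (t * (1 - t))) * (2 * (k * Real.pi)) := by ring
      _ ≤ M * (2 * (k * Real.pi)) := by gcongr
  · rw [abs_mul, abs_mul, abs_of_nonneg hk]
    calc |cutoff n t| * (k * Real.pi * |Real.cos (k * Real.pi * t)|)
        ≤ 1 * (k * Real.pi * 1) := by
          gcongr
          · exact abs_cutoff_le n t
          · exact Real.abs_cos_le_one _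
      _ = k * Real.pi := by ring

theorem eventually_cutSine_eq (k : ℕ) {t : ℝ} (ht : t ∈ Ioo (0 : ℝ) 1) :
    ∀ᶠ n in Filter.atTop,
      cutSine k n =ᶠ[nhds t] fun t => Real.sin (k * Real.pi * t) := by
  have hs : 0 < t * (1 - t) := mul_pos ht.1 (by linarith [ht.2])
  -- Once `n t(1 - t) > 2`, the argument of the transition exceeds `1` on a neighbourhood of `t`,
  -- where the cutoff is identically `1`.
  obtain ⟨N, hN⟩ := exists_nat_gt (2 / (t * (1 - t)))
  filter_upwards [Filter.eventually_ge_atTop N] with n hn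
  have h1 : 2 < (n : ℝ) * (t * (1 - t)) := by
    rw [div_lt_iff₀ hs] at hN
    exact hN.trans_le (by gcongr)
  have hc : Continuous fun t : ℝ => (n : ℝ) * (t * (1 - t)) := by fun_prop
  filter_upwards [hc.continuousAt.preimage_mem_nhds (Ioi_mem_nhds h1)] with s hs
  have hs' : 2 < (n : ℝ) * (s * (1 - s)) := hs
  rw [cutSine, cutoff, Real.smoothTransition.one_of_one_le (by linarith), one_mul]

theorem tendsto_cutSine (k : ℕ) {t : ℝ} (ht : t ∈ Ioo (0 : ℝ) 1) :
    Filter.Tendsto (fun n => cutSine k n t) Filter.atTop (nhds (Real.sin (k * Real.pi * t))) := by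
  refine tendsto_const_nhds.congr' ?_
  filter_upwards [eventually_cutSine_eq k ht] with n hn
  exact hn.eq_of_nhds.symm

theorem tendsto_deriv_cutSine (k : ℕ) {t : ℝ} (ht : t ∈ Ioo (0 : ℝ) 1) :
    Filter.Tendsto (fun n => deriv (cutSine k n) t) Filter.atTop
      (nhds (k * Real.pi * Real.cos (k * Real.pi * t))) := by
  refine tendsto_const_nhds.congr' ?_
  filter_upwards [eventually_cutSine_eq k ht] with n hn
  rw [hn.deriv_eq, (deriv_sine k t).deriv]

end Cutoff

/-! ### Tensor products of functions of one variable and their gradients -/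

section Tensor

/-- `f ⊗ g`, as a function on the plane. -/
def tensor (f g : ℝ → ℝ) (x : EuclideanSpace ℝ (Fin 2)) : ℝ := f (x 0) * g (x 1)

theorem contDiff_tensor {f g : ℝ → ℝ} (hf : ContDiff ℝ ∞ f) (hg : ContDiff ℝ ∞ g) :
    ContDiff ℝ ∞ (tensor f g) :=
  (hf.comp (EuclideanSpace.proj (𝕜 := ℝ) (0 : Fin 2)).contDiff).mul
    (hg.comp (EuclideanSpace.proj (𝕜 := ℝ) (1 : Fin 2)).contDiff)

theorem hasFDerivAt_tensor {f g : ℝ → ℝ} {f' g' : ℝ} {x : EuclideanSpace ℝ (Fin 2)}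
    (hf : HasDerivAt f f' (x 0)) (hg : HasDerivAt g g' (x 1)) :
    HasFDerivAt (tensor f g)
      (f (x 0) • g' • EuclideanSpace.proj (𝕜 := ℝ) (1 : Fin 2) +
        g (x 1) • f' • EuclideanSpace.proj (𝕜 := ℝ) (0 : Fin 2)) x := by
  have h0 : HasFDerivAt (fun x : EuclideanSpace ℝ (Fin 2) => f (x 0))
      (f' • EuclideanSpace.proj (𝕜 := ℝ) (0 : Fin 2)) x :=
    hf.comp_hasFDerivAt x (EuclideanSpace.proj (𝕜 := ℝ) (0 : Fin 2)).hasFDerivAt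
  have h1 : HasFDerivAt (fun x : EuclideanSpace ℝ (Fin 2) => g (x 1))
      (g' • EuclideanSpace.proj (𝕜 := ℝ) (1 : Fin 2)) x :=
    hg.comp_hasFDerivAt x (EuclideanSpace.proj (𝕜 := ℝ) (1 : Fin 2)).hasFDerivAt
  exact h0.mul h1

theorem partial_zero_tensor {f g f' g' : ℝ → ℝ} (hf : ∀ t, HasDerivAt f (f' t) t)
    (hg : ∀ t, HasDerivAt g (g' t) t) :
    (fun x => fderiv ℝ (tensor f g) x (EuclideanSpace.single 0 1)) = tensor f' g := by
  ext x
  rw [(hasFDerivAt_tensor (hf _) (hg _)).fderiv]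
  simp [tensor, mul_comm]

theorem partial_one_tensor {f g f' g' : ℝ → ℝ} (hf : ∀ t, HasDerivAt f (f' t) t)
    (hg : ∀ t, HasDerivAt g (g' t) t) :
    (fun x => fderiv ℝ (tensor f g) x (EuclideanSpace.single 1 1)) = tensor f g' := by
  ext x
  rw [(hasFDerivAt_tensor (hf _) (hg _)).fderiv]
  simp [tensor]

theorem gradient_tensor {f g f' g' : ℝ → ℝ} (hf : ∀ t, HasDerivAt f (f' t) t)
    (hg : ∀ t, HasDerivAt g (g' t) t) (x : EuclideanSpace ℝ (Fin 2)) :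
    gradient (tensor f g) x = !₂[tensor f' g x, tensor f g' x] := by
  ext i
  rw [gradient_apply]
  fin_cases i
  · exact congrFun (partial_zero_tensor hf hg) x
  · exact congrFun (partial_one_tensor hf hg) x

theorem norm_vec_le (a b : ℝ) : ‖(!₂[a, b] : EuclideanSpace ℝ (Fin 2))‖ ≤ |a| + |b| := by
  rw [EuclideanSpace.norm_eq, Real.sqrt_le_iff]
  refine ⟨by positivity, ?_⟩
  simp only [Fin.sum_univ_two, Real.norm_eq_abs, Matrix.cons_val_zero, Matrix.cons_val_one]
  nlinarith [abs_nonneg a, abs_nonneg b]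

end Tensor

/-! ### The sine products as elements of `H₀¹` of the square -/

section Square

theorem square_subset_ball : square ⊆ Metric.closedBall 0 2 := by
  intro x hx
  rw [mem_closedBall_zero_iff, EuclideanSpace.norm_eq, Real.sqrt_le_iff]
  refine ⟨by norm_num, ?_⟩
  have h0 := hx 0
  have h1 := hx 1
  simp only [Fin.sum_univ_two, Real.norm_eq_abs, sq_abs]
  nlinarith [h0.1, h0.2, h1.1, h1.2]

instance : IsFiniteMeasure (volume.restrict square) :=
  isFiniteMeasure_restrict.2
    ((measure_mono square_subset_ball).trans_lt measure_closedBall_lt_top).ne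

theorem memLp_square_of_continuous {F : Type*} [NormedAddCommGroup F]
    {w : EuclideanSpace ℝ (Fin 2) → F} (hw : Continuous w)
    (hm : AEStronglyMeasurable w (volume.restrict square)) (p : ℝ≥0∞) :
    MemLp w p (volume.restrict square) := by
  obtain ⟨C, hC⟩ := (isCompact_closedBall (0 : EuclideanSpace ℝ (Fin 2)) 2).exists_bound_of_continuousOn
    hw.continuousOn
  exact MemLp.of_bound hm C ((ae_restrict_iff' isOpen_square.measurableSet).2
    (Filter.Eventually.of_forall fun x hx => hC x (square_subset_ball hx)))

/-- The support lies in the closed set where `n x_i (1 - x_i) ≥ 1` for both coordinates. That set is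
contained in the open square, and is empty when `n = 0`. -/
theorem isTest_cutSine (j k n : ℕ) : IsTest square (tensor (cutSine j n) (cutSine k n)) := by
  set S : Set (EuclideanSpace ℝ (Fin 2)) := {x | ∀ i, 1 ≤ (n : ℝ) * (x i * (1 - x i))} with hS
  have hSc : IsClosed S := by
    have : S = ⋂ i, {x | 1 ≤ (n : ℝ) * (x i * (1 - x i))} := by ext x; simp [hS]
    rw [this]
    exact isClosed_iInter fun i => isClosed_le continuous_const (by fun_prop)
  have hSs : S ⊆ square := by
    intro x hx i
    have h1 : 1 ≤ (n : ℝ) * (x i * (1 - x i)) := hx i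
    have h2 : 0 < x i * (1 - x i) := by
      by_contra! h
      nlinarith [mul_nonneg (Nat.cast_nonneg (α := ℝ) n) (neg_nonneg.2 h)]
    constructor <;> nlinarith
  have hsup : tsupport (tensor (cutSine j n) (cutSine k n)) ⊆ S := by
    refine closure_minimal ?_ hSc
    intro x hx i
    by_contra! h
    refine hx ?_
    rw [tensor]
    fin_cases i
    · rw [cutSine_eq_zero (t := x 0) h, zero_mul]
    · rw [cutSine_eq_zero (t := x 1) h, mul_zero]
  refine ⟨contDiff_tensor (contDiff_cutSine j n) (contDiff_cutSine k n), ?_, hsup.trans hSs⟩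
  exact (isCompact_closedBall (0 : EuclideanSpace ℝ (Fin 2)) 2).of_isClosed_subset
    (isClosed_tsupport _) ((hsup.trans hSs).trans square_subset_ball)

/-- `sin(jπx) sin(kπy)`. -/
def sineFun (j k : ℕ) : EuclideanSpace ℝ (Fin 2) → ℝ :=
  tensor (fun t => Real.sin (j * Real.pi * t)) fun t => Real.sin (k * Real.pi * t)

theorem contDiff_sineFun (j k : ℕ) : ContDiff ℝ ∞ (sineFun j k) :=
  contDiff_tensor (contDiff_sine j) (contDiff_sine k)

theorem memLp_sineFun (j k : ℕ) : MemLp (sineFun j k) 2 (volume.restrict square) :=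
  memLp_square_of_continuous (contDiff_sineFun j k).continuous
    (contDiff_sineFun j k).continuous.aestronglyMeasurable 2

theorem memLp_gradient_sineFun (j k : ℕ) :
    MemLp (gradient (sineFun j k)) 2 (volume.restrict square) :=
  memLp_square_of_continuous (continuous_gradient (contDiff_sineFun j k))
    (continuous_gradient (contDiff_sineFun j k)).aestronglyMeasurable 2

/-- The cut-off sines and their gradients are bounded uniformly in `n` and at each point of the
square are eventually equal to their limits, so `mem_H10_of_tendsto` applies. -/
theorem sinePair_mem (j k : ℕ) :
    WithLp.toLp 2 ((memLp_sineFun j k).toLp _, (memLp_gradient_sineFun j k).toLp _) ∈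
      H10 square := by
  obtain ⟨C, hC0, hC⟩ := exists_bound_deriv_cutSine j
  obtain ⟨D, hD0, hD⟩ := exists_bound_deriv_cutSine k
  have hd : ∀ k n t, HasDerivAt (cutSine k n) (deriv (cutSine k n) t) t := fun k n t =>
    ((contDiff_cutSine k n).differentiable (by simp) t).hasDerivAt
  refine mem_H10_of_tendsto (C := 1 + C + D) isOpen_square.measurableSet
    (fun n => isTest_cutSine j k n) ?_ ?_ ?_ ?_
  · intro n x _
    rw [tensor, norm_mul]
    have := mul_le_one₀ (abs_cutSine_le j n (x 0)) (abs_nonneg _) (abs_cutSine_le k n (x 1))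
    simp only [Real.norm_eq_abs]
    linarith
  · intro n x hx
    rw [gradient_tensor (hd j n) (hd k n)]
    refine (norm_vec_le _ _).trans ?_
    rw [tensor, tensor, abs_mul, abs_mul]
    have h1 : |deriv (cutSine j n) (x 0)| * |cutSine k n (x 1)| ≤ C * 1 :=
      mul_le_mul (hC n _ (hx 0)) (abs_cutSine_le k n _) (abs_nonneg _) hC0
    have h2 : |cutSine j n (x 0)| * |deriv (cutSine k n) (x 1)| ≤ 1 * D :=
      mul_le_mul (abs_cutSine_le j n _) (hD n _ (hx 1)) (abs_nonneg _) zero_le_one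
    linarith
  · filter_upwards [(memLp_sineFun j k).coeFn_toLp, ae_restrict_mem isOpen_square.measurableSet]
      with x hx hxs
    change Filter.Tendsto _ _ (nhds ((memLp_sineFun j k).toLp _ x))
    rw [hx]
    exact (tendsto_cutSine j (hxs 0)).mul (tendsto_cutSine k (hxs 1))
  · filter_upwards [(memLp_gradient_sineFun j k).coeFn_toLp,
      ae_restrict_mem isOpen_square.measurableSet] with x hx hxs
    change Filter.Tendsto _ _ (nhds ((memLp_gradient_sineFun j k).toLp _ x))
    rw [hx, sineFun, gradient_tensor (deriv_sine j) (deriv_sine k)]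
    simp only [gradient_tensor (hd j _) (hd k _)]
    refine (PiLp.continuous_toLp 2 _).continuousAt.tendsto.comp (tendsto_pi_nhds.2 fun i => ?_)
    fin_cases i
    · exact (tendsto_deriv_cutSine j (hxs 0)).mul (tendsto_cutSine k (hxs 1))
    · exact (tendsto_cutSine j (hxs 0)).mul (tendsto_deriv_cutSine k (hxs 1))

/-- `sin(jπx) sin(kπy)` as an element of `H₀¹` of the unit square. -/
def sine (j k : ℕ) : H10 square := ⟨_, sinePair_mem j k⟩

theorem incl_sine (j k : ℕ) : incl square (sine j k) =ᵐ[volume.restrict square] sineFun j k :=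
  (memLp_sineFun j k).coeFn_toLp

theorem grad_sine (j k : ℕ) :
    grad square (sine j k) =ᵐ[volume.restrict square] gradient (sineFun j k) :=
  (memLp_gradient_sineFun j k).coeFn_toLp

end Square

/-! ### Weak eigenvalue equation, orthogonality, and the symmetric part of the advection -/

section Identities

/-- Integration by parts against `w = ∂₀ e_jk`, which need not vanish on the boundary; membership of
`v` in `H₀¹` removes the boundary term, and `∂₀ w = -(jπ)² e_jk`. -/
theorem integral_partial_zero_sine (j k : ℕ) (v : H10 square) :
    ∫ x in square, grad square (sine j k) x 0 * grad square v x 0 =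
      (j * Real.pi) ^ 2 * ⟪incl square (sine j k), incl square v⟫ := by
  set w : EuclideanSpace ℝ (Fin 2) → ℝ := tensor (fun t => j * Real.pi * Real.cos (j * Real.pi * t))
    fun t => Real.sin (k * Real.pi * t) with hw
  have hws : ContDiff ℝ ∞ w :=
    contDiff_tensor (contDiff_const.mul (Real.contDiff_cos.comp (by fun_prop))) (contDiff_sine k)
  have hp : (fun x => fderiv ℝ w x (EuclideanSpace.single 0 1)) =
      fun x => -(j * Real.pi) ^ 2 * sineFun j k x := by
    rw [hw, partial_zero_tensor (fun t => (deriv_cosine j t).const_mul _) (deriv_sine k)]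
    ext x
    simp only [tensor, sineFun]
    ring
  have key := integral_incl_mul_partial hws 0
    (memLp_square_of_continuous hws.continuous hws.continuous.aestronglyMeasurable 2)
    (memLp_square_of_continuous (continuous_partial hws 0)
      (continuous_partial hws 0).aestronglyMeasurable 2) v
  have e1 : ∫ x in square, grad square (sine j k) x 0 * grad square v x 0 =
      ∫ x in square, grad square v x 0 * w x := by
    refine integral_congr_ae ?_
    filter_upwards [grad_sine j k] with x hx
    rw [hx, sineFun, gradient_tensor (deriv_sine j) (deriv_sine k), mul_comm]
    rfl
  have e2 : ∫ x in square, incl square v x * fderiv ℝ w x (EuclideanSpace.single 0 1) =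
      -((j * Real.pi) ^ 2 * ⟪incl square (sine j k), incl square v⟫) := by
    rw [inner_L2_eq_integral, ← neg_mul, ← integral_const_mul]
    refine integral_congr_ae ?_
    filter_upwards [incl_sine j k] with x hx
    rw [congrFun hp x, hx]
    ring
  rw [e1]
  linarith

theorem integral_partial_one_sine (j k : ℕ) (v : H10 square) :
    ∫ x in square, grad square (sine j k) x 1 * grad square v x 1 =
      (k * Real.pi) ^ 2 * ⟪incl square (sine j k), incl square v⟫ := by
  set w : EuclideanSpace ℝ (Fin 2) → ℝ := tensor (fun t => Real.sin (j * Real.pi * t))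
    fun t => k * Real.pi * Real.cos (k * Real.pi * t) with hw
  have hws : ContDiff ℝ ∞ w :=
    contDiff_tensor (contDiff_sine j) (contDiff_const.mul (Real.contDiff_cos.comp (by fun_prop)))
  have hp : (fun x => fderiv ℝ w x (EuclideanSpace.single 1 1)) =
      fun x => -(k * Real.pi) ^ 2 * sineFun j k x := by
    rw [hw, partial_one_tensor (deriv_sine j) (fun t => (deriv_cosine k t).const_mul _)]
    ext x
    simp only [tensor, sineFun]
    ring
  have key := integral_incl_mul_partial hws 1
    (memLp_square_of_continuous hws.continuous hws.continuous.aestronglyMeasurable 2)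
    (memLp_square_of_continuous (continuous_partial hws 1)
      (continuous_partial hws 1).aestronglyMeasurable 2) v
  have e1 : ∫ x in square, grad square (sine j k) x 1 * grad square v x 1 =
      ∫ x in square, grad square v x 1 * w x := by
    refine integral_congr_ae ?_
    filter_upwards [grad_sine j k] with x hx
    rw [hx, sineFun, gradient_tensor (deriv_sine j) (deriv_sine k), mul_comm]
    rfl
  have e2 : ∫ x in square, incl square v x * fderiv ℝ w x (EuclideanSpace.single 1 1) =
      -((k * Real.pi) ^ 2 * ⟪incl square (sine j k), incl square v⟫) := by
    rw [inner_L2_eq_integral, ← neg_mul, ← integral_const_mul]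
    refine integral_congr_ae ?_
    filter_upwards [incl_sine j k] with x hx
    rw [congrFun hp x, hx]
    ring
  rw [e1]
  linarith

/-- The weak eigenvalue equation of the Dirichlet Laplacian. -/
theorem inner_sine (j k : ℕ) (v : H10 square) :
    ⟪sine j k, v⟫ = (1 + beta j k) * ⟪incl square (sine j k), incl square v⟫ := by
  rw [inner_H10, inner_L2Vec_eq_sum, Fin.sum_univ_two, integral_partial_zero_sine,
    integral_partial_one_sine, beta]
  ring

/-- The integral of a product of like partial derivatives is symmetric in the two sines, so the
inner product `I` satisfies `(jπ)² I = (j'π)² I` and `(kπ)² I = (k'π)² I`. Treating each coordinate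
separately covers distinct pairs with equal `β`, such as `(1, 2)` and `(2, 1)`. -/
theorem inner_incl_sine_sine {j k j' k' : ℕ} (h : (j, k) ≠ (j', k')) :
    ⟪incl square (sine j k), incl square (sine j' k')⟫ = 0 := by
  have hpi := Real.pi_pos
  have aux : ∀ a b : ℕ, a ≠ b → ∀ I : ℝ, (a * Real.pi) ^ 2 * I = (b * Real.pi) ^ 2 * I → I = 0 := by
    intro a b hab I hI
    have h1 : ((a : ℝ) ^ 2 - (b : ℝ) ^ 2) ≠ 0 := by
      rw [sub_ne_zero]
      exact_mod_cast fun h => hab (Nat.pow_left_injective two_ne_zero h)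
    have h2 : ((a : ℝ) ^ 2 - (b : ℝ) ^ 2) * (Real.pi ^ 2 * I) = 0 := by linarith
    exact (mul_eq_zero.1 ((mul_eq_zero.1 h2).resolve_left h1)).resolve_left (by positivity)
  have hz := integral_partial_zero_sine j k (sine j' k')
  have ho := integral_partial_one_sine j k (sine j' k')
  have hz' := integral_partial_zero_sine j' k' (sine j k)
  have ho' := integral_partial_one_sine j' k' (sine j k)
  rw [real_inner_comm] at hz' ho'
  simp only [mul_comm (grad square (sine j' k') _ _)] at hz' ho'
  by_cases hj : j = j'
  · have hk : k ≠ k' := fun hk => h (by rw [hj, hk])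
    exact aux k k' hk _ (ho.symm.trans ho')
  · exact aux j j' hj _ (hz.symm.trans hz')

theorem sine_ne_zero {j k : ℕ} (hj : 1 ≤ j) (hk : 1 ≤ k) : sine j k ≠ 0 := by
  intro h0
  have h1 : ∀ᵐ x ∂volume.restrict square, sineFun j k x = 0 := by
    filter_upwards [incl_sine j k, Lp.coeFn_zero ℝ 2 (volume.restrict square)] with x hx hx0
    rw [← hx, h0, map_zero, hx0]
    rfl
  have h2 : EqOn (sineFun j k) (fun _ => 0) square :=
    Measure.eqOn_open_of_ae_eq h1 isOpen_square
      (contDiff_sineFun j k).continuous.continuousOn continuousOn_const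
  -- Both sine factors equal `1` at the point `(1/(2j), 1/(2k))` of the square.
  have aux : ∀ n : ℕ, 1 ≤ n → (1 / (2 * n) : ℝ) ∈ Ioo (0 : ℝ) 1 ∧
      Real.sin (n * Real.pi * (1 / (2 * n))) = 1 := by
    intro n hn
    have hn' : (1 : ℝ) ≤ n := by exact_mod_cast hn
    refine ⟨⟨by positivity, ?_⟩, ?_⟩
    · rw [div_lt_one (by positivity)]
      linarith
    · rw [show (n : ℝ) * Real.pi * (1 / (2 * n)) = Real.pi / 2 by field_simp]
      exact Real.sin_pi_div_two
  have h3 := h2 (x := !₂[1 / (2 * j), 1 / (2 * k)]) (by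
    intro i
    fin_cases i
    · exact (aux j hj).1
    · exact (aux k hk).1)
  have h4 : Real.sin (j * Real.pi * (1 / (2 * j))) * Real.sin (k * Real.pi * (1 / (2 * k))) = 0 := h3
  rw [(aux j hj).2, (aux k hk).2] at h4
  norm_num at h4

theorem incl_advect_toH10_ae {φ : EuclideanSpace ℝ (Fin 2) → ℝ} (hφ : IsTest square φ) :
    advect fieldLp hφ.toH10 =ᵐ[volume.restrict square]
      fun x => x 0 / 2 * gradient φ x 0 + x 1 / 2 * gradient φ x 1 := by
  filter_upwards [advect_ae fieldLp hφ.toH10, memLp_field.coeFn_toLp, hφ.grad_toH10]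
    with x h1 h2 h3
  rw [h1, h3, fieldLp, h2, PiLp.inner_apply, Fin.sum_univ_two]
  simp [field, mul_comm]

/-- `(b · ∇u, v)₀ + (u, b · ∇v)₀ = -(u, v)₀`, since `div b = 1`. -/
theorem inner_advect_add (u v : H10 square) :
    ⟪advect fieldLp u, incl square v⟫ + ⟪incl square u, advect fieldLp v⟫ =
      -⟪incl square u, incl square v⟫ := by
  have key : innerSL ℝ (advect fieldLp u) ∘L incl square +
      innerSL ℝ (incl square u) ∘L advect fieldLp = -(innerSL ℝ (incl square u) ∘L incl square) := by
    refine H10_functional_ext fun φ hφ => ?_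
    change ⟪advect fieldLp u, incl square hφ.toH10⟫ +
      ⟪incl square u, advect fieldLp hφ.toH10⟫ = -⟪incl square u, incl square hφ.toH10⟫
    -- The components of `b`. The weak gradient of `u` is tested with `w i * φ`; the product rule
    -- yields an extra `φ / 2` for each coordinate, and the two add up to `(div b) φ = φ`.
    set w : Fin 2 → EuclideanSpace ℝ (Fin 2) → ℝ := fun i x => x i / 2 with hw
    have hws : ∀ i, ContDiff ℝ ∞ (w i) := fun i =>
      (EuclideanSpace.proj (𝕜 := ℝ) i).contDiff.div_const 2
    have ht : ∀ i, IsTest square fun x => w i x * φ x := fun i => hφ.smooth_mul (hws i)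
    have hgr : ∀ i x, gradient (fun x => w i x * φ x) x i = w i x * gradient φ x i + φ x / 2 := by
      intro i x
      have hwd : HasFDerivAt (w i) ((2 : ℝ)⁻¹ • EuclideanSpace.proj (𝕜 := ℝ) i) x := by
        have := (EuclideanSpace.proj (𝕜 := ℝ) i).hasFDerivAt (x := x) |>.const_smul (2 : ℝ)⁻¹
        refine this.congr_of_eventuallyEq (Filter.Eventually.of_forall fun y => ?_)
        change y i / 2 = 2⁻¹ * y i
        ring
      have : HasFDerivAt (fun x => w i x * φ x) _ x := hwd.mul (hφ.smooth.differentiable (by simp) x).hasFDerivAt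
      rw [gradient_apply, gradient_apply, this.fderiv]
      simp
      ring
    have hu := Lp.memLp (incl square u)
    have hint : ∀ i, Integrable (fun x => incl square u x * gradient (fun x => w i x * φ x) x i)
        (volume.restrict square) := fun i =>
      hu.integrable_mul (memLp_coord (ht i).memLp_gradient i)
    have hint' : ∀ i, Integrable (fun x => grad square u x i * (w i x * φ x))
        (volume.restrict square) := fun i =>
      (memLp_coord (Lp.memLp (grad square u)) i).integrable_mul (ht i).memLp
    have hadd : Integrable (fun x => incl square u x * gradient (fun x => w 0 x * φ x) x 0 +
        incl square u x * gradient (fun x => w 1 x * φ x) x 1) (volume.restrict square) :=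
      (hint 0).add (hint 1)
    have hint2 : Integrable (fun x => incl square u x * φ x) (volume.restrict square) :=
      hu.integrable_mul hφ.memLp
    have e1 : ⟪advect fieldLp u, incl square hφ.toH10⟫ =
        (∫ x in square, grad square u x 0 * (w 0 x * φ x)) +
          ∫ x in square, grad square u x 1 * (w 1 x * φ x) := by
      rw [inner_L2_eq_integral, ← integral_add (hint' 0) (hint' 1)]
      refine integral_congr_ae ?_
      filter_upwards [advect_ae fieldLp u, memLp_field.coeFn_toLp, hφ.incl_toH10] with x h1 h2 h3
      rw [h1, h3, fieldLp, h2]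
      simp [field, PiLp.inner_apply, hw]
      ring
    have e3 : ⟪incl square u, incl square hφ.toH10⟫ = ∫ x in square, incl square u x * φ x := by
      rw [inner_L2_eq_integral]
      refine integral_congr_ae ?_
      filter_upwards [hφ.incl_toH10] with x h3
      rw [h3]
    have e2 : ⟪incl square u, advect fieldLp hφ.toH10⟫ =
        (∫ x in square, incl square u x * gradient (fun x => w 0 x * φ x) x 0) +
          (∫ x in square, incl square u x * gradient (fun x => w 1 x * φ x) x 1) -
          ∫ x in square, incl square u x * φ x := by
      rw [inner_L2_eq_integral, ← integral_add (hint 0) (hint 1),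
        ← integral_sub hadd hint2]
      refine integral_congr_ae ?_
      filter_upwards [incl_advect_toH10_ae hφ] with x h1
      simp only [h1, hgr]
      simp only [hw]
      ring
    rw [e1, e2, e3, isWeakGradient_grad u _ (ht 0) 0, isWeakGradient_grad u _ (ht 1) 1]
    ring
  exact DFunLike.congr_fun key v

end Identities

/-! ### Totality of the sine products in `L²` -/

section Completeness

/-- `cos(πx_i)`. -/
def cosMap (i : Fin 2) : C(EuclideanSpace ℝ (Fin 2), ℝ) :=
  ⟨fun x => Real.cos (Real.pi * x i), by fun_prop⟩

theorem sineFun_zero_left (k : ℕ) : sineFun 0 k = 0 := by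
  ext x; simp [sineFun, tensor]

theorem sineFun_zero_right (j : ℕ) : sineFun j 0 = 0 := by
  ext x; simp [sineFun, tensor]

/-- Multiplication by `cos(πt)` keeps the span of the sines invariant. The index is shifted by one
so that the lower neighbour is again a natural number. -/
theorem sin_mul_cos_pi (j : ℕ) (t : ℝ) :
    Real.sin ((j + 1 : ℕ) * Real.pi * t) * Real.cos (Real.pi * t) =
      1 / 2 * Real.sin ((j + 2 : ℕ) * Real.pi * t) + 1 / 2 * Real.sin (j * Real.pi * t) := by
  rw [show ((j + 2 : ℕ) : ℝ) * Real.pi * t = (j + 1 : ℕ) * Real.pi * t + Real.pi * t by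
      push_cast; ring,
    show (j : ℝ) * Real.pi * t = (j + 1 : ℕ) * Real.pi * t - Real.pi * t by push_cast; ring,
    Real.sin_add, Real.sin_sub]
  ring

/-- The products `sin(jπx) sin(kπy)` are total in `L²` of the unit square. -/
theorem eq_zero_of_inner_sine (v : L2 square) (hv : ∀ j k, ⟪incl square (sine j k), v⟫ = 0) :
    v = 0 := by
  have hint : ∀ w : EuclideanSpace ℝ (Fin 2) → ℝ, Continuous w →
      Integrable (fun x => v x * w x) (volume.restrict square) := fun w hw =>
    (Lp.memLp v).integrable_mul (memLp_square_of_continuous hw hw.aestronglyMeasurable 2)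
  have hsc : ∀ j k, Continuous (sineFun j k) := fun j k => (contDiff_sineFun j k).continuous
  have hscm : ∀ j k (h : EuclideanSpace ℝ (Fin 2) → ℝ), Continuous h →
      Continuous fun x => sineFun j k x * h x := fun j k h hh => (hsc j k).mul hh
  -- The multipliers `h` for which `v h` remains orthogonal to every sine product. `S` contains `1`
  -- and is stable under the two cosines, hence under the algebra they generate. Index `0` is
  -- allowed so that the recurrence stays within the family.
  let S : Set C(EuclideanSpace ℝ (Fin 2), ℝ) :=
    {h | ∀ j k, ∫ x in square, v x * (sineFun j k x * h x) = 0}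
  have h1S : (1 : C(EuclideanSpace ℝ (Fin 2), ℝ)) ∈ S := by
    intro j k
    rw [← hv j k, inner_L2_eq_integral]
    refine integral_congr_ae ?_
    filter_upwards [incl_sine j k] with x hx
    rw [hx]
    simp [mul_comm]
  have half : ∀ (a b c : EuclideanSpace ℝ (Fin 2) → ℝ), Continuous a → Continuous b →
      (∫ x in square, v x * a x = 0) → (∫ x in square, v x * b x = 0) →
      (∀ x, c x = 1 / 2 * a x + 1 / 2 * b x) → ∫ x in square, v x * c x = 0 := by
    intro a b c ha hb ha0 hb0 hc
    have : (fun x => v x * c x) = fun x => 1 / 2 * (v x * a x) + 1 / 2 * (v x * b x) := by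
      ext x; rw [hc]; ring
    rw [this, integral_add ((hint a ha).const_mul _) ((hint b hb).const_mul _),
      integral_const_mul, integral_const_mul, ha0, hb0]
    ring
  have hcos : ∀ i, ∀ h ∈ S, cosMap i * h ∈ S := by
    intro i h hh j k
    fin_cases i
    · rcases j with _ | j
      · simp [sineFun_zero_left]
      · refine half _ _ _ (hscm _ _ _ h.continuous) (hscm _ _ _ h.continuous)
          (hh (j + 2) k) (hh j k) fun x => ?_
        have := sin_mul_cos_pi j (x 0)
        simp only [sineFun, tensor, cosMap, ContinuousMap.mul_apply, ContinuousMap.coe_mk,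
          Fin.zero_eta]
        linear_combination (Real.sin (k * Real.pi * x 1) * h x) * this
    · rcases k with _ | k
      · simp [sineFun_zero_right]
      · refine half _ _ _ (hscm _ _ _ h.continuous) (hscm _ _ _ h.continuous)
          (hh j (k + 2)) (hh j k) fun x => ?_
        have := sin_mul_cos_pi k (x 1)
        simp only [sineFun, tensor, cosMap, ContinuousMap.mul_apply, ContinuousMap.coe_mk,
          Fin.mk_one]
        linear_combination (Real.sin (j * Real.pi * x 0) * h x) * this
  set A := Algebra.adjoin ℝ (range cosMap) with hA
  have hAS : ∀ g ∈ A, ∀ h ∈ S, g * h ∈ S := by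
    intro g hg
    induction hg using Algebra.adjoin_induction with
    | mem g hg =>
      obtain ⟨i, rfl⟩ := hg
      exact hcos i
    | algebraMap r =>
      intro h hh j k
      have : (fun x => v x * (sineFun j k x * (algebraMap ℝ C(EuclideanSpace ℝ (Fin 2), ℝ) r * h) x))
          = fun x => r * (v x * (sineFun j k x * h x)) := by
        ext x
        simp
        ring
      rw [this, integral_const_mul, hh j k, mul_zero]
    | add g₁ g₂ _ _ h₁ h₂ =>
      intro h hh j k
      have : (fun x => v x * (sineFun j k x * ((g₁ + g₂) * h) x)) =
          fun x => v x * (sineFun j k x * (g₁ * h) x) + v x * (sineFun j k x * (g₂ * h) x) := by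
        ext x
        simp
        ring
      rw [this, integral_add (hint _ (hscm j k _ (g₁ * h).continuous))
        (hint _ (hscm j k _ (g₂ * h).continuous)), h₁ h hh j k, h₂ h hh j k, add_zero]
    | mul g₁ g₂ _ _ h₁ h₂ =>
      intro h hh
      rw [mul_assoc]
      exact h₁ _ (h₂ h hh)
  let Q : Set (EuclideanSpace ℝ (Fin 2)) := {x | ∀ i, x i ∈ Icc (0 : ℝ) 1}
  have hsQ : square ⊆ Q := fun x hx i => Ioo_subset_Icc_self (hx i)
  have hQ : IsCompact Q := by
    have hcl : IsClosed Q := by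
      have : Q = ⋂ i, {x | x i ∈ Icc (0 : ℝ) 1} := by ext x; simp [Q]
      rw [this]
      exact isClosed_iInter fun i =>
        isClosed_Icc.preimage (EuclideanSpace.proj (𝕜 := ℝ) i).continuous
    refine (isCompact_closedBall (0 : EuclideanSpace ℝ (Fin 2)) 2).of_isClosed_subset hcl ?_
    intro x hx
    rw [mem_closedBall_zero_iff, EuclideanSpace.norm_eq, Real.sqrt_le_iff]
    refine ⟨by norm_num, ?_⟩
    have h0 := hx 0
    have h1 := hx 1
    simp only [Fin.sum_univ_two, Real.norm_eq_abs, sq_abs]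
    nlinarith [h0.1, h0.2, h1.1, h1.2]
  have : CompactSpace Q := isCompact_iff_compactSpace.1 hQ
  let ι : C(Q, EuclideanSpace ℝ (Fin 2)) := ⟨Subtype.val, continuous_subtype_val⟩
  let B := A.map (ContinuousMap.compRightAlgHom ℝ ℝ ι)
  -- On the closed square each `πx_i` lies in `[0, π]`, where the cosine is injective.
  have hB : B.SeparatesPoints := by
    intro x y hxy
    obtain ⟨i, hi⟩ : ∃ i, (x : EuclideanSpace ℝ (Fin 2)) i ≠ (y : EuclideanSpace ℝ (Fin 2)) i := by
      by_contra! h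
      exact hxy (Subtype.ext (PiLp.ext h))
    refine ⟨_, ⟨(cosMap i).comp ι, ⟨cosMap i, Algebra.subset_adjoin ⟨i, rfl⟩, rfl⟩, rfl⟩, ?_⟩
    intro h
    have hm : ∀ z : Q, Real.pi * (z : EuclideanSpace ℝ (Fin 2)) i ∈ Icc 0 Real.pi := fun z =>
      ⟨mul_nonneg Real.pi_pos.le (z.2 i).1, mul_le_of_le_one_right Real.pi_pos.le (z.2 i).2⟩
    exact hi (mul_left_cancel₀ Real.pi_ne_zero (Real.injOn_cos (hm x) (hm y) h))
  -- Uniform approximation by the cosine algebra shows that `v e_11` annihilates all continuous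
  -- functions. Hence `v e_11 = 0` almost everywhere, and `e_11 > 0` on the open square forces `v =
  -- 0`.
  have hzero : ∀ φ : EuclideanSpace ℝ (Fin 2) → ℝ, Continuous φ →
      ∫ x in square, v x * (sineFun 1 1 x * φ x) = 0 := by
    intro φ hφ
    have hI := hint _ (hsc 1 1)
    set c := ∫ x in square, ‖v x * sineFun 1 1 x‖ with hc
    have hc0 : 0 ≤ c := integral_nonneg fun x => norm_nonneg _
    refine norm_le_zero_iff.1 (le_of_forall_pos_le_add fun ε hε => ?_)
    -- The `+ 1` keeps the tolerance meaningful when `c = 0`.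
    have hδ : 0 < ε / (c + 1) := by positivity
    obtain ⟨⟨_, P, hP, rfl⟩, hPφ⟩ := ContinuousMap.exists_mem_subalgebra_near_continuous_of_separatesPoints
      B hB (fun x => φ x) (hφ.comp continuous_subtype_val) (ε / (c + 1)) hδ
    have hP0 : ∫ x in square, v x * (sineFun 1 1 x * P x) = 0 := by
      have := hAS P hP 1 h1S 1 1
      rwa [mul_one] at this
    have hbound : ‖∫ x in square, (v x * (sineFun 1 1 x * φ x) - v x * (sineFun 1 1 x * P x))‖ ≤
        ∫ x in square, ‖v x * sineFun 1 1 x‖ * (ε / (c + 1)) := by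
      refine norm_integral_le_of_norm_le (hI.norm.mul_const _) ?_
      refine (ae_restrict_iff' isOpen_square.measurableSet).2 (Filter.Eventually.of_forall ?_)
      intro x hx
      have h1 : ‖P x - φ x‖ < ε / (c + 1) := hPφ ⟨x, hsQ hx⟩
      rw [show v x * (sineFun 1 1 x * φ x) - v x * (sineFun 1 1 x * P x) =
        v x * sineFun 1 1 x * (φ x - P x) by ring, norm_mul, norm_sub_rev]
      exact mul_le_mul_of_nonneg_left h1.le (norm_nonneg _)
    rw [integral_sub (hint _ (hscm 1 1 _ hφ)) (hint _ (hscm 1 1 _ P.continuous)), hP0,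
      sub_zero, integral_mul_const] at hbound
    rw [zero_add]
    refine hbound.trans ?_
    rw [← hc, mul_div_assoc', div_le_iff₀ (by positivity)]
    nlinarith
  have hae : ∀ᵐ x, x ∈ square → v x * sineFun 1 1 x = 0 := by
    refine isOpen_square.ae_eq_zero_of_integral_contDiff_smul_eq_zero
      (locallyIntegrableOn_of_locallyIntegrable_restrict (hint _ (hsc 1 1)).locallyIntegrable) ?_
    intro φ hφ _ hs
    rw [← hzero φ hφ.continuous, ← setIntegral_eq_integral_of_forall_compl_eq_zero (s := square)]
    · refine integral_congr_ae (Filter.Eventually.of_forall fun x => ?_)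
      simp only [smul_eq_mul]
      ring
    · intro x hx
      rw [image_eq_zero_of_notMem_tsupport fun h => hx (hs h), zero_smul]
  refine Lp.ext ?_
  rw [← ae_restrict_iff' isOpen_square.measurableSet] at hae
  filter_upwards [hae, ae_restrict_mem isOpen_square.measurableSet,
    Lp.coeFn_zero ℝ 2 (volume.restrict square)] with x hx hxs hx0
  have hs : ∀ i, 0 < Real.sin ((1 : ℕ) * Real.pi * x i) := fun i => by
    rw [Nat.cast_one, one_mul]
    exact Real.sin_pos_of_pos_of_lt_pi (mul_pos Real.pi_pos (hxs i).1)
      (mul_lt_of_lt_one_right Real.pi_pos (hxs i).2)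
  rw [hx0]
  exact (mul_eq_zero.1 hx).resolve_right (mul_pos (hs 0) (hs 1)).ne'

end Completeness

/-! ### Spectrum of `R_V⁻¹ A`, and its transfer to `K` and the form `a` -/

/-- The Riesz representative `R_V⁻¹ A` of `A`. -/
def symOp : H10 square ≃L[ℝ] H10 square :=
  (exists_equiv_inner_sub_half (norm_incl_le (Ω := square))).choose

theorem inner_symOp (u v : H10 square) :
    ⟪symOp u, v⟫ = ⟪u, v⟫ - 1 / 2 * ⟪incl square u, incl square v⟫ :=
  (exists_equiv_inner_sub_half (norm_incl_le (Ω := square))).choose_spec u v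

theorem inner_smul_H10 (c : ℝ) (u v : H10 square) : ⟪c • u, v⟫ = c * ⟪u, v⟫ :=
  real_inner_smul_left u v c

theorem form_sq (u v : H10 square) :
    ⟪sqL u, sqM v⟫ = ⟪u, v⟫ + ⟪advect fieldLp u, incl square v⟫ := by
  have h := form_opL_opM fieldLp u v
  rw [inner_H10]
  exact h.trans (by ring)

/-- Each of the two terms is `(u, v)_V` plus an advective term; by `inner_advect_add` the advective
terms average to `-½ (u, v)₀`. -/
theorem inner_symmetrized (u v : H10 square) :
    (1 / 2 : ℝ) * (⟪sqL u, sqM v⟫ + ⟪sqM u, sqL v⟫) = ⟪symOp u, v⟫ := by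
  rw [real_inner_comm (sqL v) (sqM u), form_sq, form_sq, inner_symOp, real_inner_comm u v,
    real_inner_comm (incl square u) (advect fieldLp v)]
  linarith [inner_advect_add u v]

theorem form_self (u : H10 square) : form sqL sqM u u = ⟪symOp u, u⟫ := by
  rw [← inner_symmetrized, real_inner_comm (sqL u) (sqM u), form]
  ring

theorem beta_nonneg (m n : ℕ) : 0 ≤ beta m n := by
  unfold beta
  positivity

theorem beta_eq_iff {j k m n : ℕ} : beta j k = beta m n ↔ j ^ 2 + k ^ 2 = m ^ 2 + n ^ 2 := by
  unfold beta
  rw [mul_left_inj' (pow_ne_zero 2 Real.pi_ne_zero)]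
  exact_mod_cast Iff.rfl

/-- The eigenvalue of `K` as a function of the eigenvalue `β` of the Laplacian. -/
def kappa (β : ℝ) : ℝ := (2 + 2 * β) / (1 + 2 * β)

theorem kappa_pos {β : ℝ} (h : 0 ≤ β) : 0 < kappa β := by
  unfold kappa
  positivity

theorem kappa_eq_one_add {β : ℝ} (h : 0 ≤ β) : kappa β = 1 + (1 + 2 * β)⁻¹ := by
  unfold kappa
  field_simp
  ring

theorem kappa_inj {β γ : ℝ} (hβ : 0 ≤ β) (hγ : 0 ≤ γ) : kappa β = kappa γ ↔ β = γ := by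
  rw [kappa_eq_one_add hβ, kappa_eq_one_add hγ, add_right_inj, inv_inj, add_right_inj,
    mul_right_inj' two_ne_zero]

theorem kappa_inv_le {β γ : ℝ} (hβ : 0 ≤ β) (h : β ≤ γ) : (kappa β)⁻¹ ≤ (kappa γ)⁻¹ := by
  refine inv_anti₀ (kappa_pos (hβ.trans h)) ?_
  rw [kappa_eq_one_add hβ, kappa_eq_one_add (hβ.trans h)]
  gcongr

/-- By `inner_sine`, `(e, v)₀ = (e, v)_V / (1 + β)`, so the form of `symOp` multiplies `(e, v)_V` by
`1 - 1 / (2(1 + β))`. -/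
theorem symOp_sine (j k : ℕ) : symOp (sine j k) = (kappa (beta j k))⁻¹ • sine j k := by
  refine ext_inner_right ℝ fun v => ?_
  have hb := beta_nonneg j k
  rw [inner_symOp, inner_smul_H10, inner_sine, kappa, inv_div]
  field_simp
  ring

theorem symOp_symm (u v : H10 square) : ⟪symOp u, v⟫ = ⟪u, symOp v⟫ := by
  rw [real_inner_comm (symOp v) u, inner_symOp, inner_symOp, real_inner_comm u v,
    real_inner_comm (incl square u)]

/-- Indices of the eigenfunctions. -/
abbrev Index : Type := {p : ℕ × ℕ // 1 ≤ p.1 ∧ 1 ≤ p.2}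

/-- Orthogonality in `V` is orthogonality in `L²` because `1 + β ≠ 0`, and sines with a zero index
vanish. Completeness in `L²` and injectivity of the inclusion conclude. -/
theorem sine_total (v : H10 square) (h : ∀ p : Index, ⟪sine p.1.1 p.1.2, v⟫ = 0) : v = 0 := by
  refine incl_injective isOpen_square v (eq_zero_of_inner_sine _ fun j k => ?_)
  by_cases hjk : 1 ≤ j ∧ 1 ≤ k
  · have h1 := h ⟨(j, k), hjk⟩
    rw [inner_sine] at h1
    exact (mul_eq_zero.1 h1).resolve_left (by linarith [beta_nonneg j k])
  · have h0 : sineFun j k = 0 := by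
      rcases not_and_or.1 hjk with h | h
      · rw [show j = 0 by omega, sineFun_zero_left]
      · rw [show k = 0 by omega, sineFun_zero_right]
    rw [inner_L2_eq_integral]
    refine integral_eq_zero_of_ae ?_
    filter_upwards [incl_sine j k] with x hx
    rw [hx, h0]
    simp

theorem sine_orthogonal (p q : Index) (h : p ≠ q) :
    ⟪sine p.1.1 p.1.2, sine q.1.1 q.1.2⟫ = 0 := by
  rw [inner_sine, inner_incl_sine_sine fun h' => h (Subtype.ext h'), mul_zero]

theorem eigenspace_symOp (m n : ℕ) :
    Module.End.eigenspace (symOp : H10 square →L[ℝ] H10 square).toLinearMap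
        (kappa (beta m n))⁻¹ =
      Submodule.span ℝ {u | ∃ j k : ℕ, 1 ≤ j ∧ 1 ≤ k ∧ j ^ 2 + k ^ 2 = m ^ 2 + n ^ 2 ∧
        u = sine j k} := by
  have hiff : ∀ p : Index, (kappa (beta p.1.1 p.1.2))⁻¹ = (kappa (beta m n))⁻¹ ↔
      p.1.1 ^ 2 + p.1.2 ^ 2 = m ^ 2 + n ^ 2 := fun p => by
    rw [inv_inj, kappa_inj (beta_nonneg _ _) (beta_nonneg _ _), beta_eq_iff]
  -- Both indices are at most `m² + n²`, since `j ≤ j²`.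
  have hfin : {p : Index | (kappa (beta p.1.1 p.1.2))⁻¹ = (kappa (beta m n))⁻¹}.Finite := by
    refine Set.Finite.of_finite_image ((((finite_Iic (m ^ 2 + n ^ 2)).prod
      (finite_Iic (m ^ 2 + n ^ 2)))).subset ?_) Subtype.val_injective.injOn
    rintro _ ⟨p, hp, rfl⟩
    have hp' := (hiff p).1 hp
    exact ⟨by simp only [mem_Iic]; nlinarith [Nat.le_self_pow two_ne_zero p.1.1],
      by simp only [mem_Iic]; nlinarith [Nat.le_self_pow two_ne_zero p.1.2]⟩
  rw [eigenspace_eq_span_of_total (T := (symOp : H10 square →L[ℝ] H10 square)) symOp_symm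
    (e := fun p : Index => sine p.1.1 p.1.2) (fun p => symOp_sine p.1.1 p.1.2) sine_total hfin]
  congr 1
  ext u
  constructor
  · rintro ⟨p, hp, rfl⟩
    exact ⟨p.1.1, p.1.2, p.2.1, p.2.2, (hiff p).1 hp, rfl⟩
  · rintro ⟨j, k, hj, hk, h, rfl⟩
    exact ⟨⟨(j, k), hj, hk⟩, (hiff _).2 h, rfl⟩

theorem eigenspace_opK_sq (m n : ℕ) :
    Module.End.eigenspace (opK sqL sqM).toLinearMap (kappa (beta m n)) =
      Submodule.span ℝ {u | ∃ j k : ℕ, 1 ≤ j ∧ 1 ≤ k ∧ j ^ 2 + k ^ 2 = m ^ 2 + n ^ 2 ∧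
        u = sine j k} := by
  rw [eigenspace_opK_of_inner inner_symmetrized (kappa_pos (beta_nonneg m n)).ne',
    eigenspace_symOp]

theorem hasEigenvalue_opK_sq (κ : ℝ) :
    Module.End.HasEigenvalue (opK sqL sqM).toLinearMap κ ↔
      ∃ m n : ℕ, 1 ≤ m ∧ 1 ≤ n ∧ κ = kappa (beta m n) := by
  rw [Module.End.hasEigenvalue_iff]
  -- Passing to the reciprocal eigenvalue of `symOp` needs `κ ≠ 0`; the value `0` is excluded
  -- because `K` is injective.
  by_cases hκ : κ = 0
  · rw [hκ, eigenspace_opK_zero_of_inner inner_symmetrized]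
    refine iff_of_false (fun h => h rfl) ?_
    rintro ⟨m, n, -, -, h⟩
    exact (kappa_pos (beta_nonneg m n)).ne h
  · rw [eigenspace_opK_of_inner inner_symmetrized hκ, ← Module.End.hasEigenvalue_iff,
      hasEigenvalue_iff_of_total (T := (symOp : H10 square →L[ℝ] H10 square)) symOp_symm
        (e := fun p : Index => sine p.1.1 p.1.2) (fun p => symOp_sine p.1.1 p.1.2)
        (fun p => sine_ne_zero p.2.1 p.2.2) sine_total]
    constructor
    · rintro ⟨p, hp⟩
      exact ⟨p.1.1, p.1.2, p.2.1, p.2.2, (inv_inj.1 hp).symm⟩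
    · rintro ⟨m, n, hm, hn, h⟩
      exact ⟨⟨(m, n), hm, hn⟩, by rw [h]⟩

theorem kappa_beta_one_one : (kappa (beta 1 1))⁻¹ = (1 + 4 * Real.pi ^ 2) / (2 + 4 * Real.pi ^ 2) := by
  rw [kappa, inv_div, beta]
  norm_num
  ring_nf

theorem le_form_self (u : H10 square) : (kappa (beta 1 1))⁻¹ * ‖u‖ ^ 2 ≤ form sqL sqM u u := by
  rw [form_self]
  refine mul_norm_sq_le_inner_of_total (T := (symOp : H10 square →L[ℝ] H10 square)) symOp_symm
    (e := fun p : Index => sine p.1.1 p.1.2) (fun p => symOp_sine p.1.1 p.1.2)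
    (fun p => sine_ne_zero p.2.1 p.2.2) sine_orthogonal sine_total (fun p => ?_) u
  -- The eigenvalue of `symOp` increases with `β`, so its minimum occurs at the smallest `β`, that
  -- is at `(1, 1)`.
  refine kappa_inv_le (beta_nonneg 1 1) ?_
  have h1 : (1 : ℝ) ≤ p.1.1 := by exact_mod_cast p.2.1
  have h2 : (1 : ℝ) ≤ p.1.2 := by exact_mod_cast p.2.2
  unfold beta
  push_cast
  gcongr

theorem form_sine_self :
    form sqL sqM (sine 1 1) (sine 1 1) = (kappa (beta 1 1))⁻¹ * ‖sine 1 1‖ ^ 2 := by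
  rw [form_self, symOp_sine, inner_smul_H10, real_inner_self_eq_norm_sq]

end AdvDiff

end

theorem mainTheorem8 :
    -- `A : V → V'` and `K : V → V` are invertible
    (AdvDiff.opA AdvDiff.sqL AdvDiff.sqM).IsInvertible ∧
    (AdvDiff.opK AdvDiff.sqL AdvDiff.sqM).IsInvertible ∧
    -- eigenvalues of `C` and of `K`
    {μ : ℝ | Module.End.HasEigenvalue (AdvDiff.opC AdvDiff.sqL AdvDiff.sqM).toLinearMap μ} =
      {μ : ℝ | ∃ m n : ℕ, 1 ≤ m ∧ 1 ≤ n ∧ μ = (1 + 2 * AdvDiff.beta m n)⁻¹} ∧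
    {κ : ℝ | Module.End.HasEigenvalue (AdvDiff.opK AdvDiff.sqL AdvDiff.sqM).toLinearMap κ} =
      {κ : ℝ | ∃ m n : ℕ, 1 ≤ m ∧ 1 ≤ n ∧
        κ = (2 + 2 * AdvDiff.beta m n) / (1 + 2 * AdvDiff.beta m n)} ∧
    -- eigenspaces: `e j k` is the function `sin(jπx) sin(kπy)`
    (∃ e : ℕ → ℕ → AdvDiff.H10 AdvDiff.square,
      (∀ j k : ℕ, AdvDiff.incl AdvDiff.square (e j k)
        =ᵐ[MeasureTheory.volume.restrict AdvDiff.square]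
          fun x => Real.sin (j * Real.pi * x 0) * Real.sin (k * Real.pi * x 1)) ∧
      (∀ m n : ℕ, 1 ≤ m → 1 ≤ n →
        Module.End.eigenspace (AdvDiff.opC AdvDiff.sqL AdvDiff.sqM).toLinearMap
            (1 + 2 * AdvDiff.beta m n)⁻¹ =
          Submodule.span ℝ {u | ∃ j k : ℕ, 1 ≤ j ∧ 1 ≤ k ∧ j ^ 2 + k ^ 2 = m ^ 2 + n ^ 2 ∧
            u = e j k} ∧
        Module.End.eigenspace (AdvDiff.opK AdvDiff.sqL AdvDiff.sqM).toLinearMap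
            ((2 + 2 * AdvDiff.beta m n) / (1 + 2 * AdvDiff.beta m n)) =
          Submodule.span ℝ {u | ∃ j k : ℕ, 1 ≤ j ∧ 1 ≤ k ∧ j ^ 2 + k ^ 2 = m ^ 2 + n ^ 2 ∧
            u = e j k}) ∧
      Module.End.eigenspace (AdvDiff.opK AdvDiff.sqL AdvDiff.sqM).inverse.toLinearMap
          ((1 + 4 * Real.pi ^ 2) / (2 + 4 * Real.pi ^ 2)) = Submodule.span ℝ {e 1 1}) ∧
    -- the coercivity constant
    AdvDiff.IsCoercivityConstant (AdvDiff.form AdvDiff.sqL AdvDiff.sqM)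
      ((1 + 4 * Real.pi ^ 2) / (2 + 4 * Real.pi ^ 2)) ∧
    IsGLB {q : ℝ | ∃ u : AdvDiff.H10 AdvDiff.square, u ≠ 0 ∧
        q = AdvDiff.form AdvDiff.sqL AdvDiff.sqM u u / ‖u‖ ^ 2}
      ((1 + 4 * Real.pi ^ 2) / (2 + 4 * Real.pi ^ 2)) := by
  have hK := AdvDiff.opK_eq_of_inner AdvDiff.inner_symmetrized
  have hne : 0 < ‖AdvDiff.sine 1 1‖ ^ 2 :=
    pow_pos (norm_pos_iff.2 (AdvDiff.sine_ne_zero le_rfl le_rfl)) 2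
  have hC : ∀ m n : ℕ, 1 + (1 + 2 * AdvDiff.beta m n)⁻¹ = AdvDiff.kappa (AdvDiff.beta m n) :=
    fun m n => (AdvDiff.kappa_eq_one_add (AdvDiff.beta_nonneg m n)).symm
  have hα : 0 < (AdvDiff.kappa (AdvDiff.beta 1 1))⁻¹ :=
    inv_pos.2 (AdvDiff.kappa_pos (AdvDiff.beta_nonneg 1 1))
  refine ⟨?_, ?_, ?_, ?_, ⟨AdvDiff.sine, AdvDiff.incl_sine, fun m n _ _ => ⟨?_, ?_⟩, ?_⟩, ?_, ?_⟩
  · rw [AdvDiff.opA_eq_of_inner AdvDiff.inner_symmetrized]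
    exact ⟨_, rfl⟩
  · rw [hK]
    exact ⟨_, rfl⟩
  · ext μ
    simp only [Set.mem_ofPred_eq]
    rw [Module.End.hasEigenvalue_iff, AdvDiff.eigenspace_opC, ← Module.End.hasEigenvalue_iff,
      AdvDiff.hasEigenvalue_opK_sq]
    simp only [← hC, add_right_inj]
  · ext κ
    exact AdvDiff.hasEigenvalue_opK_sq κ
  · rw [AdvDiff.eigenspace_opC, hC, AdvDiff.eigenspace_opK_sq]
  · exact AdvDiff.eigenspace_opK_sq m n
  · rw [hK, ContinuousLinearMap.inverse_equiv, ContinuousLinearEquiv.symm_symm,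
      ← AdvDiff.kappa_beta_one_one, AdvDiff.eigenspace_symOp]
    congr 1
    ext u
    constructor
    · rintro ⟨j, k, hj, hk, h, rfl⟩
      -- The only positive integers with `j² + k² = 2` are `j = k = 1`, so this eigenspace is a
      -- line.
      obtain rfl : j = 1 := by nlinarith
      obtain rfl : k = 1 := by nlinarith
      rfl
    · rintro rfl
      exact ⟨1, 1, le_rfl, le_rfl, rfl, rfl⟩
  · rw [← AdvDiff.kappa_beta_one_one]
    refine ⟨⟨hα, AdvDiff.le_form_self⟩, fun c hc => ?_⟩
    -- Equality holds at `e_11`, so no larger constant is admissible.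
    have h := hc.2 (AdvDiff.sine 1 1)
    rw [AdvDiff.form_sine_self] at h
    exact le_of_mul_le_mul_right h hne
  · rw [← AdvDiff.kappa_beta_one_one]
    refine IsLeast.isGLB ⟨⟨AdvDiff.sine 1 1, AdvDiff.sine_ne_zero le_rfl le_rfl, ?_⟩, ?_⟩
    · rw [AdvDiff.form_sine_self, mul_div_cancel_right₀ _ hne.ne']
    · rintro q ⟨u, hu, rfl⟩
      rw [le_div_iff₀ (pow_pos (norm_pos_iff.2 hu) 2)]
      exact AdvDiff.le_form_self u
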